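/- Let $\mathcal D$ be a triangulated category with small coproducts. For a class $\mathcal S$ of objects, $\mathcal S^{\perp}$ is the full subcategory of the objects $M$ with $\mathcal D(S,M)=0$ for all $S\in\mathcal S$; $\mathcal S^{+}$ is the class of all shifts $S[n]$, $n\ge 0$, $S\in\mathcal S$; $\mathrm{Sum}(\mathcal S)$ is the class of all small coproducts of objects of $\mathcal S$; $\mathcal S^{*m}$ ($m\ge 0$) is the class of $m$-fold extensions of objects of $\mathcal S$; $\mathrm{Tria}_{\mathcal D}(\mathcal S)$ is the smallest full triangulated subcategory of $\mathcal D$ containing $\mathcal S$ and closed under small coproducts; and $\mathrm{aisle}(\mathcal S)$ is the smallest aisle (left part $\mathcal D^{\le 0}$ of a t-structure) of $\mathcal D$ containing $\mathcal S$ (it exists if $\mathcal S$ is a set of perfect objects). An object $P$ of a triangulated category $\mathcal C$ is *perfect* (respectively *superperfect*) in $\mathcal C$ if for every countable (respectively small) family of morphisms $M_i\to N_i$ of $\mathcal C$ such that $\coprod M_i$ and $\coprod N_i$ exist in $\mathcal C$ and all maps $\mathcal C(P,M_i)\to\mathcal C(P,N_i)$ are surjective, the map $\mathcal C(P,\coprod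 M_i)\to\mathcal C(P,\coprod N_i)$ is surjective. A class $\mathcal Q$ *generates* $\mathcal C$ if $M=0$ whenever $\mathcal C(Q[n],M)=0$ for all $Q\in\mathcal Q$, $n\in\mathbf Z$. The category $\mathcal C$ is *exhaustively generated to the left* by a set $\mathcal P$ of its objects if small coproducts of objects of $\bigcup_{m\ge 0}\mathrm{Sum}(\mathcal P^{+})^{*m}$ exist in $\mathcal C$ and for each object $M$ of $\mathcal C$ there are $i\in\mathbf Z$, objects $Q_n\in\bigcup_{m\ge0}\mathrm{Sum}(\mathcal P^{+})^{*m}$ ($n\ge 0$) and a triangle $\coprod_{n\ge0}Q_n\to\coprod_{n\ge0}Q_n\to M[i]\to\coprod_{n\ge0}Q_n[1]$ in $\mathcal C$. A *TTF triple* on $\mathcal C$ is a triple $(\mathcal X,\mathcal Y,\mathcal Z)$ of full subcategories such that $(\mathcal X,\mathcal Y)$ and $(\mathcal Y,\mathcal Z)$ are t-structures on $\mathcal C$ (in the convention $(\mathcal C^{\le0},\mathcal C^{\ge0})$). If $\mathcal C'\subseteq\mathcal C$ is a full triangulated subcategory, a TTF triple $(\mathcal X,\mathcal Y,\mathcal Z)$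 on $\mathcal C$ *restricts to* a TTF triple $(\mathcal X',\mathcal Y',\mathcal Z')$ on $\mathcal C'$ if $(\mathcal X\cap\mathcal C',\mathcal Y\cap\mathcal C',\mathcal Z\cap\mathcal C')=(\mathcal X',\mathcal Y',\mathcal Z')$. **Proposition.** Let $\mathcal Q$ be a set of perfect objects of $\mathcal D$ that generates $\mathcal D$, and suppose that $\mathrm{aisle}(\mathcal Q)^{\perp}$ is closed under small coproducts in $\mathcal D$. Put $\mathcal D'=\bigcup_{n\in\mathbf Z}\mathrm{aisle}(\mathcal Q)[n]$, a full triangulated subcategory of $\mathcal D$. Let $(\mathcal X',\mathcal Y',\mathcal Z')$ be a TTF triple on $\mathcal D'$ such that $\mathcal X'$ is exhaustively generated to the left by a set $\mathcal P$ of objects which are superperfect in $\mathcal X'$. Then: 1. the objects of $\mathcal P$ are superperfect in $\mathcal D'$; 2. $(\mathrm{Tria}_{\mathcal D}(\mathcal P),\ \mathrm{Tria}_{\mathcal D}(\mathcal P)^{\perp},\ (\mathrm{Tria}_{\mathcal D}(\mathcal P)^{\perp})^{\perp})$ is a TTF triple on $\mathcal D$ which restricts to $(\mathcal X',\mathcal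 Y',\mathcal Z')$. -/

import Mathlib

open CategoryTheory CategoryTheory.Limits CategoryTheory.Pretriangulated
open CategoryTheory.Triangulated

universe v u

namespace TTFRestriction

section Additive

variable {C : Type u} [Category.{v} C]

/-- `P` is perfect in `C`: for every countable family of morphisms `f i : M i ⟶ N i` whose
coproducts `∐ M`, `∐ N` exist in `C`, if all maps `C(P, M i) → C(P, N i)` are surjective, then so is
`C(P, ∐ M) → C(P, ∐ N)`. -/
def IsPerfect (P : C) : Prop :=
  ∀ (ι : Type) [Countable ι] (M N : ι → C) (f : ∀ i, M i ⟶ N i) [HasCoproduct M] [HasCoproduct N],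
    (∀ i, Function.Surjective (fun g : P ⟶ M i => g ≫ f i)) →
      Function.Surjective (fun g : P ⟶ ∐ M => g ≫ Limits.Sigma.map f)

/-- `P` is superperfect in `C`: the same as `IsPerfect` for arbitrary small families. -/
def IsSuperperfect (P : C) : Prop :=
  ∀ (ι : Type v) (M N : ι → C) (f : ∀ i, M i ⟶ N i) [HasCoproduct M] [HasCoproduct N],
    (∀ i, Function.Surjective (fun g : P ⟶ M i => g ≫ f i)) →
      Function.Surjective (fun g : P ⟶ ∐ M => g ≫ Limits.Sigma.map f)

/-- `Sum(Q)`: all objects which are small coproducts of objects of `Q`. -/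
def sums (Q : ObjectProperty C) : ObjectProperty C :=
  fun X => ∃ J : Type v, Q.colimitsOfShape (Discrete J) X

/-- Closure under those small coproducts that exist in `C`. -/
def ClosedUnderCoproducts (Q : ObjectProperty C) : Prop :=
  ∀ J : Type v, Q.IsClosedUnderColimitsOfShape (Discrete J)

end Additive

section Triangulated

variable {C : Type u} [Category.{v} C] [HasZeroObject C] [HasShift C ℤ] [Preadditive C]
  [∀ n : ℤ, (shiftFunctor C n).Additive] [Pretriangulated C]

/-- The class of all objects isomorphic to some shift `Y⟦n⟧` with `Y` in `U` and `n : ℤ`, i.e.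
the union of all `U[n]`. -/
def unionOfShifts (U : ObjectProperty C) : ObjectProperty C :=
  fun X => ∃ (n : ℤ) (Y : C), U Y ∧ Nonempty (X ≅ Y⟦n⟧)

/-- `P⁺`: all non-negative shifts of objects of `P`. -/
def nonnegShifts (P : ObjectProperty C) : ObjectProperty C :=
  fun X => ∃ (n : ℕ) (Y : C), P Y ∧ Nonempty (X ≅ Y⟦(n : ℤ)⟧)

/-- `Q` generates `C`. -/
def Generates (Q : ObjectProperty C) : Prop :=
  ∀ M : C, (∀ X : C, Q X → ∀ (n : ℤ) (f : X⟦n⟧ ⟶ M), f = 0) → IsZero M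

/-- The union over `m ≥ 0` of the classes `Q^{*m}` of `m`-fold extensions of objects of `Q`.
Here `Q^{*0}` consists of the zero objects, and `Q.extensionProductIter n` is `Q^{*(n+1)}`. -/
def finiteExtensions (Q : ObjectProperty C) : ObjectProperty C :=
  fun X => IsZero X ∨ ∃ n : ℕ, Q.extensionProductIter n X

/-- `C` is exhaustively generated by `Q`. -/
structure ExhaustivelyGenerated (Q : ObjectProperty C) : Prop where
  hasCoproduct : ∀ (J : Type v) (F : J → C),
    (∀ j, finiteExtensions (sums Q) (F j)) → HasCoproduct F
  exists_triangle : ∀ M : C, ∃ (i : ℤ) (F : ℕ → C) (c : Cofan F) (_ : IsColimit c)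
    (f : c.pt ⟶ c.pt) (g : c.pt ⟶ M⟦i⟧) (h : M⟦i⟧ ⟶ c.pt⟦(1 : ℤ)⟧),
      (∀ n, finiteExtensions (sums Q) (F n)) ∧ Triangle.mk f g h ∈ distTriang C

/-- `C` is exhaustively generated to the left by `P`. -/
def ExhaustivelyGeneratedToTheLeft (P : ObjectProperty C) : Prop :=
  ExhaustivelyGenerated (nonnegShifts P)

/-- `Tria(Q)`: the smallest (strictly) full triangulated subcategory containing `Q` and closed
under small coproducts. -/
def tria (Q : ObjectProperty C) : ObjectProperty C :=
  fun X => ∀ T : ObjectProperty C, T.IsTriangulated → T.IsClosedUnderIsomorphisms →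
    ClosedUnderCoproducts T → Q ≤ T → T X

/-- `(U, W)` is a t-structure, in the convention `(D^{≤ 0}, D^{≥ 0})`. -/
def IsTStructure (U W : ObjectProperty C) : Prop :=
  ∃ t : TStructure C, t.le 0 = U ∧ t.ge 0 = W

/-- `U` is an aisle: the subcategory `D^{≤ 0}` of a t-structure. -/
def IsAisle (U : ObjectProperty C) : Prop :=
  ∃ t : TStructure C, t.le 0 = U

/-- `aisle(Q)`: the intersection of all aisles containing `Q`. -/
def aisle (Q : ObjectProperty C) : ObjectProperty C :=
  fun X => ∀ U : ObjectProperty C, IsAisle U → Q ≤ U → U X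

/-- If there is a smallest aisle containing `Q`, it is `aisle Q`. -/
lemma eq_aisle_of_isLeast {Q U : ObjectProperty C}
    (h : IsLeast {U : ObjectProperty C | IsAisle U ∧ Q ≤ U} U) : U = aisle Q :=
  le_antisymm (fun _ hX _ hV hQ => h.2 ⟨hV, hQ⟩ _ hX) (fun _ hX => hX U h.1.1 h.1.2)

/-- A TTF triple `(X, Y, Z)` on `C`: both `(X, Y)` and `(Y, Z)` are t-structures. -/
structure TTFTriple (C : Type u) [Category.{v} C] [HasZeroObject C] [HasShift C ℤ] [Preadditive C]
    [∀ n : ℤ, (shiftFunctor C n).Additive] [Pretriangulated C] where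
  X : ObjectProperty C
  Y : ObjectProperty C
  Z : ObjectProperty C
  isTStructure_XY : IsTStructure X Y
  isTStructure_YZ : IsTStructure Y Z

/-- A TTF triple `S` on `C` restricts to a TTF triple `T` on a full triangulated subcategory. -/
def TTFTriple.RestrictsTo (S : TTFTriple C) {D' : ObjectProperty C} [D'.IsTriangulated]
    (T : TTFTriple D'.FullSubcategory) : Prop :=
  S.X.inverseImage D'.ι = T.X ∧ S.Y.inverseImage D'.ι = T.Y ∧ S.Z.inverseImage D'.ι = T.Z

section Helpers

lemma aisle_iso {Q : ObjectProperty C} {X Y : C} (e : X ≅ Y) (h : aisle Q X) : aisle Q Y := by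
  intro U hU hQ
  have hX := h U hU hQ
  obtain ⟨t, rfl⟩ := hU
  exact (t.le 0).prop_of_iso e hX

lemma aisle_shift {Q : ObjectProperty C} {X : C} (h : aisle Q X) (n : ℤ) (hn : 0 ≤ n) :
    aisle Q (X⟦n⟧) := by
  intro U hU hQ
  have hX := h U hU hQ
  obtain ⟨t, rfl⟩ := hU
  exact t.le_monotone (by lia : -n ≤ 0) _ (t.le_shift 0 n (-n) (by lia) X hX)

lemma aisle_zero (Q : ObjectProperty C) {X : C} (h : IsZero X) : aisle Q X := by
  rintro U ⟨t, rfl⟩ _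
  exact (t.isLE_of_isZero h 0).le

lemma aisle_ext {Q : ObjectProperty C} (T : Triangle C) (hT : T ∈ distTriang C)
    (h₁ : aisle Q T.obj₁) (h₃ : aisle Q T.obj₃) : aisle Q T.obj₂ := by
  intro U hU hQ
  have h₁' := h₁ U hU hQ
  have h₃' := h₃ U hU hQ
  obtain ⟨t, rfl⟩ := hU
  exact (t.isLE₂ T hT 0 ⟨h₁'⟩ ⟨h₃'⟩).le

lemma unionOfShifts_iff {Q : ObjectProperty C} (X : C) :
    unionOfShifts (aisle Q) X ↔ ∃ N : ℤ, ∀ m : ℤ, N ≤ m → aisle Q (X⟦m⟧) := by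
  constructor
  · rintro ⟨n, Y, hY, ⟨e⟩⟩
    refine ⟨-n, fun m hm => ?_⟩
    exact aisle_iso ((shiftFunctorAdd' C n m (n + m) rfl).app Y ≪≫
      (shiftFunctor C m).mapIso e.symm) (aisle_shift hY (n + m) (by lia))
  · rintro ⟨N, hN⟩
    exact ⟨-N, X⟦N⟧, hN N le_rfl, ⟨(shiftEquiv C N).unitIso.app X⟩⟩

end Helpers

/-- The union of the shifts of `aisle Q` is a full triangulated subcategory. -/
instance (Q : ObjectProperty C) : (unionOfShifts (aisle Q)).IsTriangulated where
  exists_zero := ⟨_, isZero_zero C, (unionOfShifts_iff _).2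
    ⟨0, fun m _ => aisle_zero Q ((shiftFunctor C m).map_isZero (isZero_zero C))⟩⟩
  isStableUnderShiftBy a :=
    { le_shift := by
        intro X hX
        obtain ⟨N, hN⟩ := (unionOfShifts_iff X).1 hX
        refine (unionOfShifts_iff (X⟦a⟧)).2 ⟨N - a, fun m hm => ?_⟩
        exact aisle_iso ((shiftFunctorAdd' C a m (a + m) rfl).app X) (hN _ (by lia)) }
  ext₂' T hT h₁ h₃ := by
    obtain ⟨N₁, h₁⟩ := (unionOfShifts_iff _).1 h₁
    obtain ⟨N₃, h₃⟩ := (unionOfShifts_iff _).1 h₃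
    refine ObjectProperty.le_isoClosure _ _ ((unionOfShifts_iff _).2
      ⟨max N₁ N₃, fun m hm => ?_⟩)
    exact aisle_ext _ (Triangle.shift_distinguished T hT m) (h₁ m (by lia)) (h₃ m (by lia))

/-- The first term of a TTF triple is a full triangulated subcategory. -/
instance (S : TTFTriple C) : S.X.IsTriangulated := by
  obtain ⟨X, Y, Z, ⟨t, rfl, htY⟩, ⟨s, hsY, -⟩⟩ := S
  change (t.le 0).IsTriangulated
  have key : ∀ B : C, t.ge 1 B → ∀ k : ℕ, t.ge (k : ℤ) B := by
    intro B hB k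
    have h0 : t.ge 0 B := t.ge_one_le B hB
    have h1 : s.le 0 B := by rw [hsY, ← htY]; exact h0
    have h2 : s.le 0 (B⟦(k : ℤ)⟧) :=
      s.le_monotone (by lia : -(k : ℤ) ≤ 0) _ (s.le_shift 0 k (-k) (by lia) B h1)
    rw [hsY, ← htY] at h2
    rw [← t.shift_ge k 0 k (by lia)]
    exact h2
  have hle : ∀ (A : C), t.le 0 A → ∀ n : ℤ, t.le n A := by
    intro A hA n
    rcases le_total 0 n with hn | hn
    · exact t.le_monotone hn A hA
    · have : t.le 0 (A⟦n⟧) := by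
        rw [t.le_iff_isLE, t.isLE_iff_orthogonal 0 1 (by lia)]
        intro B f hB
        obtain ⟨k, hk⟩ := Int.eq_ofNat_of_zero_le (by lia : 0 ≤ -n + 1)
        have hB' : t.ge (-n + 1) B := by rw [hk]; exact key B hB.ge k
        exact t.zero_of_isLE_of_isGE f (-n) (-n + 1) (by lia)
          ⟨t.le_shift 0 n (-n) (by lia) A hA⟩ ⟨hB'⟩
      rw [← t.shift_le n 0 n (by lia)]
      exact this
  exact
    { exists_zero := ⟨_, isZero_zero C, (t.isLE_of_isZero (isZero_zero C) 0).le⟩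
      isStableUnderShiftBy := fun a =>
        { le_shift := fun A hA => t.le_shift a a 0 (by lia) A (hle A hA a) }
      ext₂' := fun T hT h₁ h₃ => ObjectProperty.le_isoClosure _ _ (t.isLE₂ T hT 0 ⟨h₁⟩ ⟨h₃⟩).le }

end Triangulated

end TTFRestriction

/-! Perfect objects play the role of compact ones: Hom out of them need not commute with coproducts,
but surjectivity survives coproducts of maps, and this suffices for homotopy colimit arguments.
Since `Q` consists of perfect objects, `aisle Q` is the aisle of a t-structure `t` on `D`
(`exists_tStructure_of_perfect`), and `D'` is the class `t.minus` of objects bounded above.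

Superperfection is lifted in three steps. Coproducts in `D` of uniformly bounded families in the
first term of the triple remain in that term, so each `P j` is superperfect in `D` for such
families. Truncating with the TTF triple extends this to all uniformly bounded families
(`PerfectFor.of_isTorsionPair`); here the middle term is closed under their coproducts because it is
itself the left part of a t-structure. Truncating with `t` extends it to all families
(`PerfectFor.top_of_isLE`), because the coaisle is closed under coproducts. Uniform bounds are
available because a summand is a retract of its coproduct, which makes coproducts existing in `D'`
coproducts in `D`.

For the TTF triple on `D`, a relative Brown representability theorem
(`exists_triangle_of_perfectFor`) shows that a localizing subcategory generated by a set of objects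
perfect inside it is the left part of a torsion pair. It applies to the objects `P j`. It also
applies to `tria(P)^⊥`: this class is closed under coproducts, the reflections of the `Q i` are
perfect in it, and they generate it (`rightOrthogonal_tria_eq_tria`). These reflections are already
formed in `D'`. Exhaustive generation puts the original first term inside `tria(P)`, and comparing
truncation triangles and orthogonals gives the restriction (`exists_extension`). -/

namespace TTFRestriction

/-! ### Exactness of Hom on distinguished triangles, and coproducts of triangles. -/

section ExactSequences

variable {C : Type u} [Category.{v} C] [HasShift C ℤ] [HasZeroObject C] [Preadditive C]
  [∀ n : ℤ, (shiftFunctor C n).Additive] [Pretriangulated C]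
  {X Y Z : C} {f : X ⟶ Y} {g : Y ⟶ Z} {h : Z ⟶ X⟦(1 : ℤ)⟧}

lemma dist_zero₁₂ (hT : Triangle.mk f g h ∈ distTriang C) : f ≫ g = 0 :=
  comp_distTriang_mor_zero₁₂ _ hT

lemma dist_zero₂₃ (hT : Triangle.mk f g h ∈ distTriang C) : g ≫ h = 0 :=
  comp_distTriang_mor_zero₂₃ _ hT

lemma dist_zero₃₁ (hT : Triangle.mk f g h ∈ distTriang C) : h ≫ f⟦(1 : ℤ)⟧' = 0 :=
  comp_distTriang_mor_zero₃₁ _ hT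

lemma dist_desc₂ (hT : Triangle.mk f g h ∈ distTriang C) {A : C} (a : Y ⟶ A) (ha : f ≫ a = 0) :
    ∃ b : Z ⟶ A, a = g ≫ b :=
  Triangle.yoneda_exact₂ _ hT a ha

lemma dist_desc₃ (hT : Triangle.mk f g h ∈ distTriang C) {A : C} (a : Z ⟶ A) (ha : g ≫ a = 0) :
    ∃ b : X⟦(1 : ℤ)⟧ ⟶ A, a = h ≫ b :=
  Triangle.yoneda_exact₃ _ hT a ha

lemma dist_desc₁ (hT : Triangle.mk f g h ∈ distTriang C) {A : C} (a : X⟦(1 : ℤ)⟧ ⟶ A)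
    (ha : h ≫ a = 0) : ∃ b : Y⟦(1 : ℤ)⟧ ⟶ A, a = f⟦(1 : ℤ)⟧' ≫ b := by
  have : ∃ b : Y⟦(1 : ℤ)⟧ ⟶ A, a = (-f⟦(1 : ℤ)⟧') ≫ b :=
    Triangle.yoneda_exact₃ _ (rot_of_distTriang _ hT) a ha
  obtain ⟨b, hb⟩ := this
  exact ⟨-b, by simp [hb]⟩

lemma dist_lift₂ (hT : Triangle.mk f g h ∈ distTriang C) {A : C} (a : A ⟶ Y) (ha : a ≫ g = 0) :
    ∃ b : A ⟶ X, a = b ≫ f :=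
  Triangle.coyoneda_exact₂ _ hT a ha

lemma dist_lift₃ (hT : Triangle.mk f g h ∈ distTriang C) {A : C} (a : A ⟶ Z) (ha : a ≫ h = 0) :
    ∃ b : A ⟶ Y, a = b ≫ g :=
  Triangle.coyoneda_exact₃ _ hT a ha

lemma dist_lift₁ (hT : Triangle.mk f g h ∈ distTriang C) {A : C} (a : A ⟶ X⟦(1 : ℤ)⟧)
    (ha : a ≫ f⟦(1 : ℤ)⟧' = 0) : ∃ b : A ⟶ Z, a = b ≫ h :=
  Triangle.coyoneda_exact₁ _ hT a ha

lemma dist_of_iso₃ (hT : Triangle.mk f g h ∈ distTriang C) {Z' : C} (e : Z ≅ Z')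
    {g' : Y ⟶ Z'} {h' : Z' ⟶ X⟦(1 : ℤ)⟧} (hg : g ≫ e.hom = g') (hh : e.hom ≫ h' = h) :
    Triangle.mk f g' h' ∈ distTriang C := by
  refine isomorphic_distinguished _ hT _ ?_
  refine Triangle.isoMk _ _ (Iso.refl X) (Iso.refl Y) e.symm ?_ ?_ ?_
  · change f ≫ 𝟙 Y = 𝟙 X ≫ f
    simp
  · change g' ≫ e.inv = 𝟙 Y ≫ g
    simp [← hg]
  · change h' ≫ (𝟙 X)⟦(1 : ℤ)⟧' = e.inv ≫ h
    simp [← hh]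

lemma dist_exists_hom₃ {X' Y' Z' : C} {f' : X' ⟶ Y'} {g' : Y' ⟶ Z'} {h' : Z' ⟶ X'⟦(1 : ℤ)⟧}
    (hT : Triangle.mk f g h ∈ distTriang C) (hT' : Triangle.mk f' g' h' ∈ distTriang C)
    (a : X ⟶ X') (b : Y ⟶ Y') (w : f ≫ b = a ≫ f') :
    ∃ c : Z ⟶ Z', g ≫ c = b ≫ g' ∧ h ≫ a⟦(1 : ℤ)⟧' = c ≫ h' :=
  complete_distinguished_triangle_morphism _ _ hT hT' a b w

end ExactSequences

section CoproductTriangle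

variable {C : Type u} [Category.{v} C] [HasShift C ℤ]

lemma shift_sigma_hom_ext {J : Type*} {X : J → C} [HasCoproduct X] {n : ℤ} {A : C}
    {f g : (∐ X)⟦n⟧ ⟶ A} (h : ∀ j, (Sigma.ι X j)⟦n⟧' ≫ f = (Sigma.ι X j)⟦n⟧' ≫ g) : f = g :=
  Cofan.IsColimit.hom_ext
    (isColimitCofanMkObjOfIsColimit (shiftFunctor C n) X (Sigma.ι X) (coproductIsCoproduct X)) _ _ h

lemma exists_shift_sigma_desc {J : Type*} {X : J → C} [HasCoproduct X] {n : ℤ} {A : C}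
    (d : ∀ j, (X j)⟦n⟧ ⟶ A) : ∃ f : (∐ X)⟦n⟧ ⟶ A, ∀ j, (Sigma.ι X j)⟦n⟧' ≫ f = d j :=
  ⟨Cofan.IsColimit.desc
    (isColimitCofanMkObjOfIsColimit (shiftFunctor C n) X (Sigma.ι X) (coproductIsCoproduct X)) d,
    fun j => Cofan.IsColimit.fac
      (isColimitCofanMkObjOfIsColimit (shiftFunctor C n) X (Sigma.ι X)
        (coproductIsCoproduct X)) d j⟩

variable [HasZeroObject C] [Preadditive C]
  [∀ n : ℤ, (shiftFunctor C n).Additive] [Pretriangulated C]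

/-- A coproduct of distinguished triangles is distinguished. -/
lemma exists_coproduct_triangle {J : Type*} {X Y Z : J → C} [HasCoproduct X] [HasCoproduct Y]
    [HasCoproduct Z] (f : ∀ j, X j ⟶ Y j) (g : ∀ j, Y j ⟶ Z j) (h : ∀ j, Z j ⟶ (X j)⟦(1 : ℤ)⟧)
    (hT : ∀ j, Triangle.mk (f j) (g j) (h j) ∈ distTriang C) :
    ∃ k : ∐ Z ⟶ (∐ X)⟦(1 : ℤ)⟧,
      Triangle.mk (Limits.Sigma.map f) (Limits.Sigma.map g) k ∈ distTriang C := by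
  obtain ⟨W, f₂, f₃, hW⟩ := distinguished_cocone_triangle (Limits.Sigma.map f)
  choose t ht₂ ht₃ using fun j =>
    dist_exists_hom₃ (hT j) hW (Sigma.ι X j) (Sigma.ι Y j) (by simp)
  let θ : ∐ Z ⟶ W := Sigma.desc t
  have hθ : ∀ j, Sigma.ι Z j ≫ θ = t j := fun j => by simp [θ]
  have hgθ : Limits.Sigma.map g ≫ θ = f₂ := by
    ext j
    simp [hθ, ht₂]
  have zero := dist_zero₃₁ hW
  have hiso : IsIso θ := by
    -- Five lemma by hand: maps out of a coproduct, or out of its shift, are families of maps, so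
    -- the Hom sequences of the given triangles can be used componentwise against that of `W`.
    refine isIso_of_coyoneda_map_bijective _ (fun A => ⟨?_, ?_⟩)
    · suffices ∀ b : W ⟶ A, θ ≫ b = 0 → b = 0 by
        intro b₁ b₂ hb
        exact sub_eq_zero.1 (this (b₁ - b₂) (by simpa [sub_eq_zero] using hb))
      intro b hb
      obtain ⟨c, rfl⟩ := dist_desc₃ hW b (by rw [← hgθ, Category.assoc, hb, comp_zero])
      choose d hd using fun j => dist_desc₁ (hT j) ((Sigma.ι X j)⟦(1 : ℤ)⟧' ≫ c) (by
        rw [reassoc_of% (ht₃ j), ← hθ, Category.assoc, hb, comp_zero])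
      obtain ⟨e, he⟩ := exists_shift_sigma_desc d
      have : c = (Limits.Sigma.map f)⟦(1 : ℤ)⟧' ≫ e := shift_sigma_hom_ext fun j => by
        rw [hd, ← he, ← Functor.map_comp_assoc, ← Functor.map_comp_assoc]
        simp
      rw [this, reassoc_of% zero, zero_comp]
    · intro a
      obtain ⟨b, hb⟩ := dist_desc₂ hW (Limits.Sigma.map g ≫ a) (by
        ext j
        simp [reassoc_of% (dist_zero₁₂ (hT j))])
      choose e he using fun j => dist_desc₃ (hT j) (Sigma.ι Z j ≫ (a - θ ≫ b)) (by
        have := Sigma.ι Y j ≫= hb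
        simp only [Limits.Sigma.ι_map_assoc] at this
        rw [Preadditive.comp_sub, Preadditive.comp_sub, this, reassoc_of% (hθ j),
          reassoc_of% (ht₂ j), sub_self])
      obtain ⟨d, hd⟩ := exists_shift_sigma_desc e
      refine ⟨b + f₃ ≫ d, ?_⟩
      change θ ≫ (b + f₃ ≫ d) = a
      rw [Preadditive.comp_add, ← eq_sub_iff_add_eq']
      ext j
      rw [he, ← hd, reassoc_of% (hθ j), ← reassoc_of% (ht₃ j)]
  exact ⟨θ ≫ f₃, dist_of_iso₃ hW (asIso θ).symm (by simp [← hgθ]) (by simp)⟩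

end CoproductTriangle

end TTFRestriction

namespace TTFRestriction

/-! ### Mapping telescopes and maps from perfect objects. -/

section Shift

variable {C : Type u} [Category.{v} C] [HasZeroMorphisms C] [HasShift C ℤ]

lemma eq_zero_of_shift {W A : C} (n : ℤ) (h : ∀ g : W ⟶ A⟦-n⟧, g = 0) (b : W⟦n⟧ ⟶ A) : b = 0 :=
  ((shiftEquiv C n).toAdjunction.homEquiv W A).injective ((h _).trans (h _).symm)

variable [∀ n : ℤ, (shiftFunctor C n).PreservesZeroMorphisms]

lemma eq_zero_of_comp_shift_eq_zero {q X Y : C} (f : X ⟶ Y)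
    (h : ∀ x : q⟦(-1 : ℤ)⟧ ⟶ X, x ≫ f = 0 → x = 0) (y : q ⟶ X⟦(1 : ℤ)⟧)
    (hy : y ≫ f⟦(1 : ℤ)⟧' = 0) : y = 0 := by
  let e := shiftFunctorCompIsoId C (1 : ℤ) (-1) (by simp)
  have h₁ : f⟦(1 : ℤ)⟧'⟦(-1 : ℤ)⟧' ≫ e.hom.app Y = e.hom.app X ≫ f := e.hom.naturality f
  have h₂ : y⟦(-1 : ℤ)⟧' ≫ e.hom.app X = 0 := h _ (by
    rw [Category.assoc, ← h₁, ← Functor.map_comp_assoc, hy, Functor.map_zero, zero_comp])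
  refine (shiftFunctor C (-1 : ℤ)).map_injective ?_
  rw [Functor.map_zero]
  exact (cancel_mono (e.hom.app X)).1 (h₂.trans zero_comp.symm)

end Shift

section Telescope

variable {C : Type u} [Category.{v} C]

/-- The shift endomorphism of `∐ M` attached to a sequence `M 0 ⟶ M 1 ⟶ ...`. -/
noncomputable def teleShift {M : ℕ → C} [HasCoproduct M] (m : ∀ k, M k ⟶ M (k + 1)) : ∐ M ⟶ ∐ M :=
  Sigma.desc fun k => m k ≫ Sigma.ι M (k + 1)

@[simp]
lemma ι_teleShift {M : ℕ → C} [HasCoproduct M] (m : ∀ k, M k ⟶ M (k + 1)) (k : ℕ) :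
    Sigma.ι M k ≫ teleShift m = m k ≫ Sigma.ι M (k + 1) := by
  simp [teleShift]

@[simp]
lemma ι_teleShift_assoc {M : ℕ → C} [HasCoproduct M] (m : ∀ k, M k ⟶ M (k + 1)) (k : ℕ) {A : C}
    (a : ∐ M ⟶ A) :
    Sigma.ι M k ≫ teleShift m ≫ a = m k ≫ Sigma.ι M (k + 1) ≫ a := by
  simp [← Category.assoc]

lemma map_comp_teleShift {M N : ℕ → C} [HasCoproduct M] [HasCoproduct N]
    (m : ∀ k, M k ⟶ M (k + 1)) (n : ∀ k, N k ⟶ N (k + 1)) (α : ∀ k, M k ⟶ N k)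
    (w : ∀ k, m k ≫ α (k + 1) = α k ≫ n k) :
    Limits.Sigma.map α ≫ teleShift n = teleShift m ≫ Limits.Sigma.map α := by
  ext k
  simp [reassoc_of% (w k)]

/-- The composition `M 0 ⟶ M k`. -/
noncomputable def seqMap {M : ℕ → C} (m : ∀ k, M k ⟶ M (k + 1)) : ∀ k, M 0 ⟶ M k
  | 0 => 𝟙 _
  | k + 1 => seqMap m k ≫ m k

lemma seqMap_succ {M : ℕ → C} (m : ∀ k, M k ⟶ M (k + 1)) (k : ℕ) :
    seqMap m (k + 1) = seqMap m k ≫ m k := rfl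

lemma exists_seqMap_succ_eq {M : ℕ → C} (m : ∀ k, M k ⟶ M (k + 1)) (k : ℕ) :
    ∃ c : M 1 ⟶ M (k + 1), seqMap m (k + 1) = m 0 ≫ c := by
  induction k with
  | zero => exact ⟨𝟙 _, by simp [seqMap]⟩
  | succ k ih =>
    obtain ⟨c, hc⟩ := ih
    exact ⟨c ≫ m (k + 1), by rw [seqMap_succ, hc, Category.assoc]⟩

lemma seqMap_comp {M : ℕ → C} {m : ∀ k, M k ⟶ M (k + 1)} {A : C} {a : ∀ k, M k ⟶ A}
    (ha : ∀ k, m k ≫ a (k + 1) = a k) (k : ℕ) : seqMap m k ≫ a k = a 0 := by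
  induction k with
  | zero => simp [seqMap]
  | succ k ih => rw [seqMap_succ, Category.assoc, ha, ih]

variable [Preadditive C]

/-- On a constant sequence, `1 - shift` is a split monomorphism. -/
lemma eq_zero_of_comp_teleShift_const {A X : C} [HasCoproduct fun _ : ℕ => A]
    (x : X ⟶ ∐ fun _ : ℕ => A) (hx : x ≫ teleShift (fun _ => 𝟙 A) = x) : x = 0 := by
  let r : (∐ fun _ : ℕ => A) ⟶ ∐ fun _ : ℕ => A :=
    Sigma.desc fun k => -∑ j ∈ Finset.range k, Sigma.ι (fun _ : ℕ => A) j
  -- The partial sums defining `r` on the summands `k` and `k + 1` differ exactly by the `k`-th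
  -- inclusion, so `r` is a retraction of `1 - shift`.
  have hr : r - teleShift (fun _ => 𝟙 A) ≫ r = 𝟙 _ := by
    ext k
    simp [r, Finset.sum_range_succ]
  rw [← Category.comp_id x, ← hr, Preadditive.comp_sub, reassoc_of% hx, sub_self]

/-- The telescope shift is the coproduct of the transition maps followed by reindexing. Hence
whatever dies one stage later in each component is annihilated by the shift. -/
lemma comp_teleShift_eq_zero {M N : ℕ → C} [HasCoproduct M] [HasCoproduct N]
    [HasCoproduct fun k => M (k + 1)]
    (m : ∀ k, M k ⟶ M (k + 1)) (a : ∀ k, N k ⟶ M k) {X : C} (x : X ⟶ ∐ N)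
    (hx : x ≫ Limits.Sigma.map (fun k => a k ≫ m k) = 0) :
    x ≫ Limits.Sigma.map a ≫ teleShift m = 0 := by
  have : Limits.Sigma.map a ≫ teleShift m = Limits.Sigma.map (fun k => a k ≫ m k) ≫
      Sigma.desc fun k => Sigma.ι M (k + 1) := by
    ext k
    simp
  rw [this, reassoc_of% hx, zero_comp]

variable [HasShift C ℤ] [HasZeroObject C]
  [∀ n : ℤ, (shiftFunctor C n).Additive] [Pretriangulated C]
  {M : ℕ → C} [HasCoproduct M] {m : ∀ k, M k ⟶ M (k + 1)}
  {B : C} {π : ∐ M ⟶ B} {δ : B ⟶ (∐ M)⟦(1 : ℤ)⟧}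

lemma teleShift_comp_π (hT : Triangle.mk (𝟙 _ - teleShift m) π δ ∈ distTriang C) :
    teleShift m ≫ π = π := by
  have := dist_zero₁₂ hT
  rw [Preadditive.sub_comp, Category.id_comp, sub_eq_zero] at this
  exact this.symm

lemma comp_ι_π (hT : Triangle.mk (𝟙 _ - teleShift m) π δ ∈ distTriang C) (k : ℕ) :
    m k ≫ Sigma.ι M (k + 1) ≫ π = Sigma.ι M k ≫ π := by
  rw [← ι_teleShift_assoc, teleShift_comp_π hT]

lemma exists_tele_desc (hT : Triangle.mk (𝟙 _ - teleShift m) π δ ∈ distTriang C) {A : C}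
    (a : ∀ k, M k ⟶ A) (ha : ∀ k, m k ≫ a (k + 1) = a k) :
    ∃ b : B ⟶ A, ∀ k, (Sigma.ι M k ≫ π) ≫ b = a k := by
  obtain ⟨b, hb⟩ := dist_desc₂ hT (Sigma.desc a) (by
    ext k
    simp [ha])
  exact ⟨b, fun k => by rw [Category.assoc, ← hb]; simp⟩

/-- The obstruction to lifting is a map from `q` to `(∐ M)⟦1⟧` killed by `1 - shift`; after
desuspension it is a shift-invariant map from `q⟦-1⟧`. -/
lemma exists_tele_lift (hT : Triangle.mk (𝟙 _ - teleShift m) π δ ∈ distTriang C) {q : C}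
    (hq : ∀ x : q⟦(-1 : ℤ)⟧ ⟶ ∐ M, x ≫ teleShift m = x → x = 0) (f : q ⟶ B) :
    ∃ g : q ⟶ ∐ M, f = g ≫ π := by
  refine dist_lift₃ hT f (eq_zero_of_comp_shift_eq_zero (𝟙 _ - teleShift m) (fun x hx => ?_) _
    (by rw [Category.assoc, dist_zero₃₁ hT, comp_zero]))
  rw [Preadditive.comp_sub, Category.comp_id, sub_eq_zero] at hx
  exact hq x hx.symm

end Telescope

section Perfect

variable {C : Type u} [Category.{v} C]

/-- `q` is perfect with respect to families, indexed by `ι`, of morphisms between objects of `T`. -/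
def PerfectFor (T : ObjectProperty C) (ι : Type*) (q : C) : Prop :=
  ∀ (M N : ι → C) (f : ∀ i, M i ⟶ N i) [HasCoproduct M] [HasCoproduct N],
    (∀ i, T (M i)) → (∀ i, T (N i)) →
    (∀ i, Function.Surjective (fun g : q ⟶ M i => g ≫ f i)) →
      Function.Surjective (fun g : q ⟶ ∐ M => g ≫ Limits.Sigma.map f)

lemma IsPerfect.perfectFor {q : C} (hq : IsPerfect q) (T : ObjectProperty C) : PerfectFor T ℕ q :=
  fun M N f _ _ _ _ h => hq ℕ M N f h

lemma PerfectFor.shift [HasShift C ℤ] {T : ObjectProperty C} [T.IsStableUnderShift ℤ] {ι : Type*}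
    [HasCoproductsOfShape ι C]
    {q : C} (hq : PerfectFor T ι q) (n : ℤ) : PerfectFor T ι (q⟦n⟧) := by
  intro M N f _ _ hM hN h y
  let φ : ∀ {A : C}, (q⟦n⟧ ⟶ A) ≃ (q ⟶ A⟦-n⟧) := (shiftEquiv C n).toAdjunction.homEquiv q _
  have hφ : ∀ {A B : C} (a : q⟦n⟧ ⟶ A) (b : A ⟶ B), φ (a ≫ b) = φ a ≫ b⟦-n⟧' :=
    fun a b => (shiftEquiv C n).toAdjunction.homEquiv_naturality_right a b
  let cM := isColimitCofanMkObjOfIsColimit (shiftFunctor C (-n)) M (Sigma.ι M)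
    (coproductIsCoproduct M)
  let cN := isColimitCofanMkObjOfIsColimit (shiftFunctor C (-n)) N (Sigma.ι N)
    (coproductIsCoproduct N)
  let eM : (∐ fun i => (M i)⟦-n⟧) ≅ (∐ M)⟦-n⟧ :=
    (coproductIsCoproduct _).coconePointUniqueUpToIso cM
  let eN : (∐ fun i => (N i)⟦-n⟧) ≅ (∐ N)⟦-n⟧ :=
    (coproductIsCoproduct _).coconePointUniqueUpToIso cN
  have hM' : ∀ i, Sigma.ι (fun i => (M i)⟦-n⟧) i ≫ eM.hom = (Sigma.ι M i)⟦-n⟧' := fun i =>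
    (coproductIsCoproduct _).comp_coconePointUniqueUpToIso_hom cM ⟨i⟩
  have hN' : ∀ i, Sigma.ι (fun i => (N i)⟦-n⟧) i ≫ eN.hom = (Sigma.ι N i)⟦-n⟧' := fun i =>
    (coproductIsCoproduct _).comp_coconePointUniqueUpToIso_hom cN ⟨i⟩
  have w : eM.hom ≫ (Limits.Sigma.map f)⟦-n⟧' =
      Limits.Sigma.map (fun i => (f i)⟦-n⟧') ≫ eN.hom := by
    ext i
    rw [reassoc_of% (hM' i), ← Functor.map_comp]
    simp [hN']
  obtain ⟨x, hx⟩ := hq (fun i => (M i)⟦-n⟧) (fun i => (N i)⟦-n⟧) (fun i => (f i)⟦-n⟧')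
    (fun i => T.le_shift _ _ (hM i)) (fun i => T.le_shift _ _ (hN i)) (fun i z => by
      obtain ⟨w, hw⟩ := h i (φ.symm z)
      exact ⟨φ w, (hφ w (f i)).symm.trans ((congrArg φ hw).trans (φ.apply_symm_apply z))⟩)
    (φ y ≫ eN.inv)
  refine ⟨φ.symm (x ≫ eM.hom), φ.injective ?_⟩
  change x ≫ Limits.Sigma.map (fun i => (f i)⟦-n⟧') = φ y ≫ eN.inv at hx
  rw [hφ, Equiv.apply_symm_apply, Category.assoc, w, reassoc_of% hx, Iso.inv_hom_id,
    Category.comp_id]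

variable [HasShift C ℤ] [HasZeroObject C] [Preadditive C]
  [∀ n : ℤ, (shiftFunctor C n).Additive] [Pretriangulated C]

/-- Countable coproducts of morphisms annihilated by maps out of a perfect object are again
annihilated. -/
lemma PerfectFor.comp_map_eq_zero {T : ObjectProperty C} [T.IsTriangulated]
    [T.IsClosedUnderIsomorphisms] {ι : Type*} [HasCoproductsOfShape ι C] {q : C}
    (hq : PerfectFor T ι q) {M N : ι → C} (f : ∀ i, M i ⟶ N i)
    (hM : ∀ i, T (M i)) (hN : ∀ i, T (N i)) (hf : ∀ i (g : q ⟶ M i), g ≫ f i = 0)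
    (g : q ⟶ ∐ M) : g ≫ Limits.Sigma.map f = 0 := by
  -- With `F i` the fibre of `f i`, the hypothesis makes every map from `q` to `M i` lift to `F i`,
  -- so perfectness applies to `F i ⟶ M i`.
  choose F a c hT using fun i => distinguished_cocone_triangle₁ (f i)
  obtain ⟨x, rfl⟩ := hq F M a
    (fun i => T.ext_of_isTriangulatedClosed₁ _ (hT i) (hM i) (hN i)) hM
    (fun i z => by
      obtain ⟨w, hw⟩ := dist_lift₂ (hT i) z (hf i z)
      exact ⟨w, hw.symm⟩) g
  have : Limits.Sigma.map a ≫ Limits.Sigma.map f = 0 := by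
    ext i
    simp [reassoc_of% (dist_zero₁₂ (hT i))]
  simp [this]

end Perfect

end TTFRestriction

namespace TTFRestriction

/-! ### The aisle generated by a set of perfect objects. -/

section Cover

variable {C : Type u} [Category.{v} C] [HasZeroMorphisms C]

lemma leftOrthogonal_sigma {V : ObjectProperty C} {ι : Type*} {X : ι → C} [HasCoproduct X]
    (hX : ∀ i, V.leftOrthogonal (X i)) : V.leftOrthogonal (∐ X) := fun _ f hY => by
  ext i
  rw [hX i (Sigma.ι X i ≫ f) hY, comp_zero]

/-- One takes the coproduct of chosen factoring objects over all pairs `(l, f)` satisfying `S`; this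
index set is small. The resulting map absorbs all prescribed maps at once and is still killed by
`z`. -/
lemma exists_cover [HasCoproducts.{v} C] {U : ObjectProperty C}
    (hU : ∀ (ι : Type v) (X : ι → C), (∀ i, U (X i)) → U (∐ X))
    {L : Type v} (p : L → C) {M Z : C} (z : M ⟶ Z) (S : ∀ l, (p l ⟶ M) → Prop)
    (hS : ∀ l f, S l f → ∃ (A : C) (a : p l ⟶ A) (b : A ⟶ M), U A ∧ a ≫ b = f ∧ b ≫ z = 0) :
    ∃ (W : C) (w : W ⟶ M), U W ∧ w ≫ z = 0 ∧ ∀ l f, S l f → ∃ c, f = c ≫ w := by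
  choose A a b hA hab hbz using hS
  let ι := Σ l, {f : p l ⟶ M // S l f}
  let X : ι → C := fun i => A i.1 i.2.1 i.2.2
  let w : ∐ X ⟶ M := Sigma.desc fun i => b i.1 i.2.1 i.2.2
  refine ⟨∐ X, w, hU _ _ fun i => hA _ _ _, ?_, fun l f hf => ?_⟩
  · ext i
    simp [w, hbz]
  · let i : ι := ⟨l, f, hf⟩
    refine ⟨a l f hf ≫ Sigma.ι X i, ?_⟩
    have : Sigma.ι X i ≫ w = b l f hf := by simp [w, i]
    rw [Category.assoc, this, hab]

end Cover

/-- Mittag-Leffler: when all restriction maps are onto, the equation "1 - shift = c" on families of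
maps to `A` is solved recursively, with a prescribed value at 0. For `c = 0` this extends a map
along the sequence. -/
lemma exists_compatible_seq {C : Type u} [Category.{v} C] [Preadditive C]
    {M : ℕ → C} (m : ∀ k, M k ⟶ M (k + 1)) {A : C} (d : M 0 ⟶ A)
    (c : ∀ k, M k ⟶ A) (h : ∀ k (a : M k ⟶ A), ∃ b, m k ≫ b = a) :
    ∃ e : ∀ k, M k ⟶ A, e 0 = d ∧ ∀ k, m k ≫ e (k + 1) = e k - c k := by
  choose b hb using h
  exact ⟨fun k => Nat.rec d (fun k x => b k (x - c k)) k, rfl, fun k => hb _ _⟩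

section PerfectAisle

variable {C : Type u} [Category.{v} C] [HasShift C ℤ] [HasZeroObject C] [Preadditive C]
  [∀ n : ℤ, (shiftFunctor C n).Additive] [Pretriangulated C]

instance isTriangulated_top : (⊤ : ObjectProperty C).IsTriangulated where
  exists_zero := ⟨_, isZero_zero C, trivial⟩
  isStableUnderShiftBy _ := { le_shift := fun _ _ => trivial }
  ext₂' _ _ _ _ := ObjectProperty.le_isoClosure _ _ trivial

/-- If the cones of the maps of a sequence are left orthogonal to `V` (up to a shift), then so are
the cones of the maps to a homotopy colimit. -/
lemma leftOrthogonal_of_tele {V : ObjectProperty C} (hV : ∀ X, V X → V (X⟦(-1 : ℤ)⟧))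
    {M : ℕ → C} [HasCoproduct M] {m : ∀ k, M k ⟶ M (k + 1)}
    {W : ℕ → C} {w : ∀ k, W k ⟶ M k} {h : ∀ k, M (k + 1) ⟶ (W k)⟦(1 : ℤ)⟧}
    (hW : ∀ k, V.leftOrthogonal (W k)) (hwm : ∀ k, Triangle.mk (w k) (m k) (h k) ∈ distTriang C)
    {B : C} {π : ∐ M ⟶ B} {δ : B ⟶ (∐ M)⟦(1 : ℤ)⟧}
    (hT : Triangle.mk (𝟙 _ - teleShift m) π δ ∈ distTriang C)
    {j : ℕ} {A : C} {a : A ⟶ M j} {c : B ⟶ A⟦(1 : ℤ)⟧}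
    (hA : Triangle.mk a (Sigma.ι M j ≫ π) c ∈ distTriang C) : V.leftOrthogonal A := by
  intro X g hX
  -- The cone of `m k` is `(W k)⟦1⟧`, so restriction along `m k` is bijective on maps to `X` and
  -- injective on maps to `X⟦1⟧`. Passing to the limit, maps `M j ⟶ X` extend to `B` and maps `B ⟶
  -- X⟦1⟧` are detected on `M j`; the long exact sequence then kills maps `A ⟶ X`.
  have ext_step : ∀ k (d : M k ⟶ X), ∃ b, m k ≫ b = d := fun k d => by
    obtain ⟨b, hb⟩ := dist_desc₂ (hwm k) d (hW k _ hX)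
    exact ⟨b, hb.symm⟩
  have inj_step : ∀ k (b : M (k + 1) ⟶ X), m k ≫ b = 0 → b = 0 := fun k b hb => by
    obtain ⟨b', rfl⟩ := dist_desc₃ (hwm k) b hb
    rw [eq_zero_of_shift 1 (fun g => hW k g (hV _ hX)) b', comp_zero]
  have inj_step' : ∀ k (b : M (k + 1) ⟶ X⟦(1 : ℤ)⟧), m k ≫ b = 0 → b = 0 := fun k b hb => by
    obtain ⟨b', rfl⟩ := dist_desc₃ (hwm k) b hb
    obtain ⟨b', rfl⟩ := (shiftFunctor C (1 : ℤ)).map_surjective b'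
    rw [hW k b' hX, Functor.map_zero, comp_zero]
  have inj : ∀ k (b : M k ⟶ X), seqMap m k ≫ b = 0 → b = 0 := fun k => by
    induction k with
    | zero => intro b hb; simpa [seqMap] using hb
    | succ k ih =>
      intro b hb
      rw [seqMap_succ, Category.assoc] at hb
      exact inj_step k b (ih _ hb)
  have hB : ∀ b : B ⟶ X⟦(1 : ℤ)⟧, (Sigma.ι M j ≫ π) ≫ b = 0 → b = 0 := fun b hb => by
    have h₀ : (Sigma.ι M 0 ≫ π) ≫ b = 0 := by
      rw [← seqMap_comp (m := m) (a := fun k => Sigma.ι M k ≫ π) (comp_ι_π hT) j, Category.assoc,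
        hb, comp_zero]
    have h₁ : ∀ k, (Sigma.ι M k ≫ π) ≫ b = 0 := fun k => by
      induction k with
      | zero => exact h₀
      | succ k ih => exact inj_step' k _ (by rw [← Category.assoc, comp_ι_π hT, ih])
    obtain ⟨e, rfl⟩ := dist_desc₃ hT b (by
      ext k
      rw [comp_zero, ← Category.assoc, h₁])
    obtain ⟨e, rfl⟩ := (shiftFunctor C (1 : ℤ)).map_surjective e
    obtain ⟨s, -, hs⟩ := exists_compatible_seq m (0 : M 0 ⟶ X) (fun k => Sigma.ι M k ≫ e) ext_step
    have : e = (𝟙 _ - teleShift m) ≫ Sigma.desc s := by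
      ext k
      simp [hs]
    rw [this, Functor.map_comp, reassoc_of% (dist_zero₃₁ hT), zero_comp]
  obtain ⟨b, hb⟩ := dist_desc₁ hA (g⟦(1 : ℤ)⟧') (hB _ (by
    rw [← Category.assoc, dist_zero₂₃ hA, zero_comp]))
  obtain ⟨b, rfl⟩ := (shiftFunctor C (1 : ℤ)).map_surjective b
  rw [← Functor.map_comp] at hb
  obtain rfl := (shiftFunctor C (1 : ℤ)).map_injective hb
  -- The restriction of `b` to `M 0` is extended along the sequence; by injectivity the extension
  -- agrees with `b` on `M j`.
  obtain ⟨s, hs₀, hs⟩ := exists_compatible_seq m (seqMap m j ≫ b) 0 ext_step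
  obtain ⟨b', hb'⟩ := exists_tele_desc hT s (fun k => by simp [hs])
  have : b = (Sigma.ι M j ≫ π) ≫ b' := by
    rw [← sub_eq_zero]
    apply inj j
    rw [Preadditive.comp_sub, hb', seqMap_comp (fun k => by simp [hs]), hs₀, sub_self]
  rw [this, ← Category.assoc, dist_zero₁₂ hA, zero_comp]

/-- Perfect objects generate a t-structure: every object is an extension of an object of `V` by an
object of `⊥V`, where `V` is the class of objects right orthogonal to the `q k`. -/
theorem exists_triangle_of_perfect [HasCoproducts.{v} C] [HasCoproductsOfShape ℕ C]
    {K : Type v} (q : K → C) (hq : ∀ k, PerfectFor ⊤ ℕ (q k)) (V : ObjectProperty C)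
    (hqV : ∀ X, V X ↔ ∀ k (f : q k ⟶ X), f = 0) (hV : ∀ X, V X → V (X⟦(-1 : ℤ)⟧)) (X : C) :
    ∃ (A B : C) (f : A ⟶ X) (g : X ⟶ B) (h : B ⟶ A⟦(1 : ℤ)⟧),
      V.leftOrthogonal A ∧ V B ∧ Triangle.mk f g h ∈ distTriang C := by
  have step : ∀ M : C, ∃ (W N : C) (w : W ⟶ M) (m : M ⟶ N) (h : N ⟶ W⟦(1 : ℤ)⟧),
      V.leftOrthogonal W ∧ Triangle.mk w m h ∈ distTriang C ∧
      (∀ k A (a : q k ⟶ A) (b : A ⟶ M), V.leftOrthogonal A → a ≫ b ≫ m = 0) ∧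
      (∀ k A (a : (q k)⟦(-1 : ℤ)⟧ ⟶ A) (b : A ⟶ M), V.leftOrthogonal A → a ≫ b ≫ m = 0) := by
    intro M
    -- The desuspensions are covered too, because lifting maps from `q k` to the homotopy colimit
    -- requires control of maps from `(q k)⟦-1⟧`.
    let p : K ⊕ K → C := Sum.elim q fun k => (q k)⟦(-1 : ℤ)⟧
    obtain ⟨W, w, hW, -, hw⟩ := exists_cover (U := V.leftOrthogonal)
      (fun _ _ => leftOrthogonal_sigma) p (0 : M ⟶ M)
      (fun l f => ∃ (A : C) (a : p l ⟶ A) (b : A ⟶ M), V.leftOrthogonal A ∧ a ≫ b = f)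
      (fun l f ⟨A, a, b, h₁, h₂⟩ => ⟨A, a, b, h₁, h₂, comp_zero⟩)
    obtain ⟨N, m, h, hT⟩ := distinguished_cocone_triangle w
    refine ⟨W, N, w, m, h, hW, hT, fun k A a b hA => ?_, fun k A a b hA => ?_⟩
    · obtain ⟨c, hc⟩ : ∃ c : q k ⟶ W, a ≫ b = c ≫ w := hw (Sum.inl k) (a ≫ b) ⟨A, a, b, hA, rfl⟩
      rw [← Category.assoc, hc, Category.assoc, dist_zero₁₂ hT, comp_zero]
    · obtain ⟨c, hc⟩ : ∃ c : (q k)⟦(-1 : ℤ)⟧ ⟶ W, a ≫ b = c ≫ w :=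
        hw (Sum.inr k) (a ≫ b) ⟨A, a, b, hA, rfl⟩
      rw [← Category.assoc, hc, Category.assoc, dist_zero₁₂ hT, comp_zero]
  choose W' N w' m' h' hW' hT' hk hk' using step
  let M : ℕ → C := fun k => Nat.rec X (fun _ Y => N Y) k
  let m : ∀ k, M k ⟶ M (k + 1) := fun k => m' (M k)
  obtain ⟨B, π, δ, hT⟩ := distinguished_cocone_triangle (𝟙 _ - teleShift m)
  choose A a c hA using fun j => distinguished_cocone_triangle₁ (Sigma.ι M j ≫ π)
  have hAV : ∀ j, V.leftOrthogonal (A j) := fun j =>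
    leftOrthogonal_of_tele hV (W := fun k => W' (M k)) (fun k => hW' _) (fun k => hT' (M k)) hT
      (hA j)
  refine ⟨A 0, B, a 0, Sigma.ι M 0 ≫ π, c 0, hAV 0, ?_, hA 0⟩
  rw [hqV]
  intro k f
  have hshift : ∀ x : (q k)⟦(-1 : ℤ)⟧ ⟶ ∐ M, x ≫ teleShift m = x → x = 0 := by
    intro x hx
    -- Compared with the constant sequence on `B`, the image of `x` is invariant and hence zero. So
    -- `x` comes from the fibres `A j`, which are left orthogonal to `V`; maps through them die at
    -- the next stage.
    have hxB : x ≫ Limits.Sigma.map (fun j => Sigma.ι M j ≫ π) = 0 :=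
      eq_zero_of_comp_teleShift_const _ (by
        rw [Category.assoc, map_comp_teleShift m (fun _ => 𝟙 B) _
          (fun k => (comp_ι_π hT k).trans (Category.comp_id _).symm), reassoc_of% hx])
    obtain ⟨t, ht⟩ := exists_coproduct_triangle _ _ _ hA
    obtain ⟨y, hy⟩ := dist_lift₂ ht x hxB
    have hy' : y ≫ Limits.Sigma.map a ≫ teleShift m = 0 := by
      refine comp_teleShift_eq_zero m a y ?_
      exact ((hq k).shift (-1)).comp_map_eq_zero _ (fun _ => trivial)
        (fun _ => trivial) (fun j g => hk' _ _ _ g (a j) (hAV j)) y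
    rw [← hx, hy, Category.assoc, hy']
  obtain ⟨g, rfl⟩ := exists_tele_lift hT hshift f
  have hqU : V.leftOrthogonal (q k) := fun Y f hY => (hqV Y).1 hY k f
  have hg : g ≫ Limits.Sigma.map (fun j => 𝟙 (M j)) ≫ teleShift m = 0 := by
    refine comp_teleShift_eq_zero m _ g ?_
    refine (hq k).comp_map_eq_zero _ (fun _ => trivial) (fun _ => trivial)
      (fun j x => ?_) g
    have := hk _ k _ (𝟙 _) x hqU
    simpa using this
  have : Limits.Sigma.map (fun j => 𝟙 (M j)) = 𝟙 _ := by ext; simp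
  rw [this, Category.id_comp] at hg
  rw [← teleShift_comp_π hT, reassoc_of% hg, zero_comp]

end PerfectAisle

end TTFRestriction

namespace TTFRestriction

/-! ### Brown representability relative to a localizing subcategory. -/

section RelativeBrown

variable {C : Type u} [Category.{v} C]

lemma eq_zero_of_comp_sigma_succ [HasZeroMorphisms C] {M : ℕ → C} [HasCoproduct M]
    [HasCoproduct fun k => M (k + 1)] {X : C} (x : X ⟶ ∐ fun k => M (k + 1))
    (hx : x ≫ Sigma.desc (fun k => Sigma.ι M (k + 1)) = 0) : x = 0 := by
  let r : ∐ M ⟶ ∐ fun k => M (k + 1) := Sigma.desc fun k => match k with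
    | 0 => 0
    | k + 1 => Sigma.ι (fun k => M (k + 1)) k
  have hr : Sigma.desc (fun k => Sigma.ι M (k + 1)) ≫ r = 𝟙 _ := by
    ext k
    simp [r]
  rw [← Category.comp_id x, ← hr, reassoc_of% hx, zero_comp]

variable [HasShift C ℤ] [HasZeroObject C] [Preadditive C]
  [∀ n : ℤ, (shiftFunctor C n).Additive] [Pretriangulated C]

/-- Maps from a perfect object to a coproduct of objects `Y i`, when all maps to `Y i` are sums of a
map factoring through `v i` and a map factoring through `c i`. -/
lemma PerfectFor.exists_decomposition {T : ObjectProperty C} [T.IsTriangulated]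
    [T.IsClosedUnderIsomorphisms] {ι : Type*} [HasCoproductsOfShape ι C] {q : C}
    (hq : PerfectFor T ι q) {V X Y : ι → C} (v : ∀ i, V i ⟶ Y i) (c : ∀ i, X i ⟶ Y i)
    (hV : ∀ i, T (V i)) (hX : ∀ i, T (X i)) (hY : ∀ i, T (Y i))
    (h : ∀ i (f : q ⟶ Y i), ∃ (a : q ⟶ V i) (b : q ⟶ X i), f = a ≫ v i + b ≫ c i)
    (f : q ⟶ ∐ Y) : ∃ (a : q ⟶ ∐ V) (b : q ⟶ ∐ X),
      f = a ≫ Limits.Sigma.map v + b ≫ Limits.Sigma.map c := by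
  obtain ⟨g, hg⟩ := hq (fun i => V i ⊞ X i) Y (fun i => biprod.desc (v i) (c i))
    (fun i => T.ext_of_isTriangulatedClosed₂ _ (binaryBiproductTriangle_distinguished (V i) (X i))
      (hV i) (hX i)) hY
    (fun i z => by
      obtain ⟨a, b, rfl⟩ := h i z
      exact ⟨biprod.lift a b, by simp⟩) f
  refine ⟨g ≫ Limits.Sigma.map (fun i => biprod.fst),
    g ≫ Limits.Sigma.map (fun i => biprod.snd), ?_⟩
  have : Limits.Sigma.map (fun i => biprod.desc (v i) (c i)) =
      Limits.Sigma.map (fun i => biprod.fst) ≫ Limits.Sigma.map v +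
        Limits.Sigma.map (fun i => biprod.snd) ≫ Limits.Sigma.map c := by
    ext i <;> simp
  dsimp only at hg
  rw [← hg, Category.assoc, Category.assoc, ← Preadditive.comp_add, this]

/-- A resolution of `X` by objects of `T`: `A 0` hits all maps from the `q l` to `X`, and each stage
kills the maps from the `q l` that vanish in `X`. Its homotopy colimit is the approximation sought.
-/
lemma exists_resolving_seq [HasCoproducts.{v} C]
    {T : ObjectProperty C} [T.IsTriangulated] [T.IsClosedUnderIsomorphisms]
    (hT : ∀ (ι : Type v) (X : ι → C), (∀ i, T (X i)) → T (∐ X))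
    {K : Type v} (q : K → C) (hqT : ∀ k, T (q k)) (X : C) :
    ∃ (A : ℕ → C) (a : ∀ k, A k ⟶ X) (n : ∀ k, A k ⟶ A (k + 1)) (V : ℕ → C) (v : ∀ k, V k ⟶ A k)
      (h : ∀ k, A (k + 1) ⟶ (V k)⟦(1 : ℤ)⟧), (∀ k, T (A k)) ∧ (∀ k, T (V k)) ∧
      (∀ k, Triangle.mk (v k) (n k) (h k) ∈ distTriang C) ∧ (∀ k, n k ≫ a (k + 1) = a k) ∧
      (∀ k l (f : q l ⟶ A k), f ≫ a k = 0 → ∃ c, f = c ≫ v k) ∧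
      ∀ l (f : q l ⟶ X), ∃ c : q l ⟶ A 0, f = c ≫ a 0 := by
  have step : ∀ Y : {Y : Over X // T Y.left}, ∃ (V : C) (Z : {Z : Over X // T Z.left})
      (v : V ⟶ Y.1.left) (n : Y.1.left ⟶ Z.1.left) (h : Z.1.left ⟶ V⟦(1 : ℤ)⟧),
      T V ∧ Triangle.mk v n h ∈ distTriang C ∧ n ≫ Z.1.hom = Y.1.hom ∧
      ∀ k (f : q k ⟶ Y.1.left), f ≫ Y.1.hom = 0 → ∃ c, f = c ≫ v := by
    intro Y
    obtain ⟨V, v, hV, hv, hfac⟩ := exists_cover hT q Y.1.hom (fun k f => f ≫ Y.1.hom = 0)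
      (fun k f hf => ⟨q k, 𝟙 _, f, hqT k, Category.id_comp _, hf⟩)
    obtain ⟨Z, n, h, hd⟩ := distinguished_cocone_triangle v
    obtain ⟨b, hb⟩ := dist_desc₂ hd _ hv
    exact ⟨V, ⟨Over.mk b, T.ext_of_isTriangulatedClosed₃ _ hd hV Y.2⟩, v, n, h, hV, hd, hb.symm,
      hfac⟩
  choose V' N v' n' h' hV' hd' hn' hfac' using step
  obtain ⟨A₀, a₀, hA₀, -, hfac₀⟩ := exists_cover hT q (0 : X ⟶ X) (fun _ _ => True)
      (fun k f _ => ⟨q k, 𝟙 _, f, hqT k, Category.id_comp _, comp_zero⟩)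
  let Y : ℕ → {Y : Over X // T Y.left} := fun k => Nat.rec ⟨Over.mk a₀, hA₀⟩ (fun _ Y => N Y) k
  exact ⟨fun k => (Y k).1.left, fun k => (Y k).1.hom, fun k => n' (Y k), fun k => V' (Y k),
    fun k => v' (Y k), fun k => h' (Y k), fun k => (Y k).2, fun k => hV' (Y k), fun k => hd' (Y k),
    fun k => hn' (Y k), fun k => hfac' (Y k), fun l f => hfac₀ l f trivial⟩

/-- A relative form of Brown representability: if the objects `q k` of `T` are perfect in `T`, then
every object has a right `T`-approximation whose cone is right orthogonal to the `q k`. -/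
theorem exists_triangle_of_perfectFor [HasCoproducts.{v} C] [HasCoproductsOfShape ℕ C]
    {T : ObjectProperty C} [T.IsTriangulated] [T.IsClosedUnderIsomorphisms]
    (hT : ∀ (ι : Type v) (X : ι → C), (∀ i, T (X i)) → T (∐ X))
    (hTN : ∀ (X : ℕ → C), (∀ i, T (X i)) → T (∐ X))
    {K : Type v} (q : K → C) (hqT : ∀ k, T (q k)) (hq : ∀ k, PerfectFor T ℕ (q k))
    (hqs : ∀ k, ∃ k', Nonempty (q k' ≅ (q k)⟦(-1 : ℤ)⟧)) (X : C) :
    ∃ (A B : C) (f : A ⟶ X) (g : X ⟶ B) (h : B ⟶ A⟦(1 : ℤ)⟧),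
      T A ∧ (∀ k (x : q k ⟶ B), x = 0) ∧ Triangle.mk f g h ∈ distTriang C := by
  obtain ⟨A, a, n, V, v, h, hA, hV, hd, hna, hfac, hsurj⟩ := exists_resolving_seq hT q hqT X
  let c := seqMap n
  have hca : ∀ k, c k ≫ a k = a 0 := seqMap_comp hna
  -- decomposition of maps to the coproduct
  have hdec : ∀ l (x : q l ⟶ ∐ A), ∃ (y : q l ⟶ ∐ V) (z : q l ⟶ ∐ fun _ : ℕ => A 0),
      x = y ≫ Limits.Sigma.map v + z ≫ Limits.Sigma.map c := fun l =>
    -- As `X` need not lie in `T`, the constant sequence on `X` is unavailable for perfectness; the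
    -- constant sequence on `A 0` replaces it. Any map to `A k` agrees in `X` with one coming from
    -- `A 0`, and the difference factors through `v k`.
    (hq l).exists_decomposition v c hV (fun _ => hA 0) hA (fun k f => by
      obtain ⟨z, hz⟩ := hsurj l (f ≫ a k)
      obtain ⟨y, hy⟩ := hfac k l (f - z ≫ c k) (by
        rw [Preadditive.sub_comp, Category.assoc, hca, hz, sub_self])
      exact ⟨y, z, by rw [← hy, sub_add_cancel]⟩)
  have hvs : ∀ l (y : q l ⟶ ∐ V), y ≫ Limits.Sigma.map v ≫ teleShift n = 0 := fun l y => by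
    refine comp_teleShift_eq_zero n v y ?_
    have : Limits.Sigma.map (fun k => v k ≫ n k) = 0 := by
      ext k
      simp [dist_zero₁₂ (hd k)]
    rw [this, comp_zero]
  have hcs : Limits.Sigma.map c ≫ teleShift n =
      teleShift (fun _ => 𝟙 (A 0)) ≫ Limits.Sigma.map c :=
    map_comp_teleShift _ _ _ fun k => Category.id_comp _
  -- maps from the constant sequence which die in the sequence already die at the first step
  have hkill : ∀ l (b : q l ⟶ ∐ fun _ : ℕ => A 0), b ≫ Limits.Sigma.map c ≫ teleShift n = 0 →
      b ≫ Limits.Sigma.map (fun _ : ℕ => n 0) = 0 := fun l b hb => by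
    have hb' : b ≫ Limits.Sigma.map (fun k => c (k + 1)) = 0 := by
      refine eq_zero_of_comp_sigma_succ _ ?_
      rw [Category.assoc, ← hb]
      congr 1
      ext k
      simp [c, seqMap_succ]
    -- A map from `q l` to the fibre of `A 0 ⟶ A (k + 1)` vanishes in `X`, hence factors through `V
    -- 0` and dies in `A 1`.
    choose F φ t hF using fun k => distinguished_cocone_triangle₁ (c (k + 1))
    obtain ⟨t', ht'⟩ := exists_coproduct_triangle _ _ _ hF
    obtain ⟨y, rfl⟩ := dist_lift₂ ht' b hb'
    have := (hq l).comp_map_eq_zero (fun k => φ k ≫ n 0)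
      (fun k => T.ext_of_isTriangulatedClosed₁ _ (hF k) (hA 0) (hA (k + 1))) (fun _ => hA 1)
      (fun k g => by
        obtain ⟨e, he⟩ := hfac 0 l (g ≫ φ k) (by
          rw [← hca (k + 1), Category.assoc, reassoc_of% (dist_zero₁₂ (hF k)), zero_comp,
            comp_zero])
        rw [← Category.assoc, he, Category.assoc, dist_zero₁₂ (hd 0), comp_zero]) y
    rw [← this, Category.assoc]
    congr 1
    ext k
    simp
  -- there are no shift-invariant maps
  have hinv : ∀ l (x : q l ⟶ ∐ A), x ≫ teleShift n = x → x = 0 := fun l x hx => by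
    obtain ⟨y, z, hyz⟩ := hdec l x
    have hx' : x = z ≫ Limits.Sigma.map c ≫ teleShift n := by
      conv_lhs => rw [← hx, hyz]
      rw [Preadditive.add_comp, Category.assoc, hvs, zero_add, Category.assoc]
    -- Invariance of `x` means that `z` and its shift have the same image in the telescope, hence
    -- already in the constant sequence on `A 1`. There `z` becomes invariant, so it vanishes.
    have h₁ := hkill l (z - z ≫ teleShift (fun _ => 𝟙 (A 0))) (by
      rw [Preadditive.sub_comp, ← hx', Category.assoc, ← reassoc_of% hcs,
        ← Category.assoc (Limits.Sigma.map c), ← Category.assoc z, ← hx', hx, sub_self])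
    have h₂ : z ≫ Limits.Sigma.map (fun _ : ℕ => n 0) = 0 := by
      refine eq_zero_of_comp_teleShift_const _ ?_
      rw [Preadditive.sub_comp, sub_eq_zero, Category.assoc,
        ← map_comp_teleShift _ (fun _ => 𝟙 (A 1)) _ (fun _ => by simp)] at h₁
      rw [Category.assoc, ← h₁]
    choose e he using exists_seqMap_succ_eq n
    rw [hx']
    refine comp_teleShift_eq_zero n c z ?_
    have : Limits.Sigma.map (fun k => c k ≫ n k) =
        Limits.Sigma.map (fun _ : ℕ => n 0) ≫ Limits.Sigma.map e := by
      ext k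
      have := he k
      rw [seqMap_succ] at this
      simp [c, reassoc_of% this]
    rw [this, reassoc_of% h₂, zero_comp]
  -- the homotopy colimit
  obtain ⟨L, π, δ, hL⟩ := distinguished_cocone_triangle (𝟙 _ - teleShift n)
  have hTL : T L := T.ext_of_isTriangulatedClosed₃ _ hL (hTN _ hA) (hTN _ hA)
  obtain ⟨p, hp⟩ := exists_tele_desc hL a hna
  have hinj : ∀ l (z : q l ⟶ L), z ≫ p = 0 → z = 0 := fun l z hz => by
    obtain ⟨l', ⟨i⟩⟩ := hqs l
    obtain ⟨g, rfl⟩ := exists_tele_lift hL (fun x hx => by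
      rw [← cancel_epi i.hom, comp_zero]
      exact hinv l' _ (by rw [Category.assoc, hx])) z
    obtain ⟨y, w, rfl⟩ := hdec l g
    have hcπ : Limits.Sigma.map c ≫ π = Sigma.desc (fun _ => 𝟙 (A 0)) ≫ Sigma.ι A 0 ≫ π := by
      ext k
      simpa using seqMap_comp (a := fun k => Sigma.ι A k ≫ π) (comp_ι_π hL) k
    have h₁ : (y ≫ Limits.Sigma.map v + w ≫ Limits.Sigma.map c) ≫ π =
        (w ≫ Sigma.desc (fun _ => 𝟙 (A 0))) ≫ Sigma.ι A 0 ≫ π := by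
      have h₂ : y ≫ Limits.Sigma.map v ≫ π = 0 := by
        rw [← teleShift_comp_π hL, ← Category.assoc (Limits.Sigma.map v), ← Category.assoc, hvs,
          zero_comp]
      rw [Preadditive.add_comp, Category.assoc, h₂, zero_add, Category.assoc, hcπ, Category.assoc]
    rw [h₁] at hz ⊢
    obtain ⟨e, he⟩ := hfac 0 l (w ≫ Sigma.desc (fun _ => 𝟙 (A 0))) (by
      rw [← hp 0, ← Category.assoc]
      exact hz)
    rw [he, Category.assoc, ← comp_ι_π hL, reassoc_of% (dist_zero₁₂ (hd 0)), zero_comp, comp_zero]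
  obtain ⟨B, g, h, hB⟩ := distinguished_cocone_triangle p
  -- Maps from the `q l` to `B` vanish because `p` is injective on maps from their desuspensions
  -- (`hinj`, `hqs`) and surjective on maps from `q l` itself, already from `A 0`.
  refine ⟨L, B, p, g, h, hTL, fun l x => ?_, hB⟩
  obtain ⟨l', ⟨i⟩⟩ := hqs l
  obtain ⟨y, rfl⟩ := dist_lift₃ hB x (eq_zero_of_comp_shift_eq_zero p (fun z hz => by
    rw [← cancel_epi i.hom, comp_zero]
    exact hinj l' _ (by rw [Category.assoc, hz, comp_zero])) _ (by
      rw [Category.assoc, dist_zero₃₁ hB, comp_zero]))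
  obtain ⟨z, rfl⟩ := hsurj l y
  rw [← hp 0, Category.assoc, Category.assoc, Category.assoc, dist_zero₁₂ hB]
  simp

end RelativeBrown

end TTFRestriction

namespace TTFRestriction

/-! ### Torsion pairs, t-structures and full subcategories. -/

section OfFullSubcategory

variable {C : Type u} [Category.{v} C] (S : ObjectProperty C)

/-- The objects of the ambient category which belong to a class of objects of a full
subcategory. -/
def ofFullSubcategory (U : ObjectProperty S.FullSubcategory) : ObjectProperty C :=
  fun X => ∃ hX : S X, U ⟨X, hX⟩

lemma ofFullSubcategory_iff {U : ObjectProperty S.FullSubcategory} (X : S.FullSubcategory) :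
    ofFullSubcategory S U X.obj ↔ U X :=
  ⟨fun h => h.2, fun h => ⟨X.property, h⟩⟩

instance [S.IsClosedUnderIsomorphisms] {U : ObjectProperty S.FullSubcategory}
    [U.IsClosedUnderIsomorphisms] : (ofFullSubcategory S U).IsClosedUnderIsomorphisms where
  of_iso := fun {X _} e ⟨hX, h⟩ =>
    ⟨S.prop_of_iso e hX, U.prop_of_iso (X := ⟨X, hX⟩) (S.isoMk e) h⟩

end OfFullSubcategory

/-- A morphism into `A⟦-n⟧` vanishes if the adjoint morphisms do. -/
lemma eq_zero_of_unshift {C : Type u} [Category.{v} C] [HasShift C ℤ] [Preadditive C]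
    [∀ n : ℤ, (shiftFunctor C n).Additive] {W A : C} (n : ℤ) (h : ∀ b : W⟦n⟧ ⟶ A, b = 0)
    (g : W ⟶ A⟦-n⟧) :
    g = 0 := by
  apply (shiftFunctor C n).map_injective
  have := h (g⟦n⟧' ≫ ((shiftEquiv C n).counitIso.app A).hom)
  rw [Functor.map_zero]
  exact (cancel_mono ((shiftEquiv C n).counitIso.app A).hom).1 (this.trans zero_comp.symm)

section TorsionPair

variable {C : Type u} [Category.{v} C] [HasZeroObject C] [HasShift C ℤ] [Preadditive C]
  [∀ n : ℤ, (shiftFunctor C n).Additive] [Pretriangulated C]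

/-- `(U, V)` is a torsion pair on the class `S` of objects: there are no nonzero morphisms from `U`
to `V`, and every object of `S` is an extension of an object of `V` by an object of `U`. -/
structure IsTorsionPair (S U V : ObjectProperty C) : Prop where
  left_le : U ≤ S
  right_le : V ≤ S
  left_iso : U.IsClosedUnderIsomorphisms
  right_iso : V.IsClosedUnderIsomorphisms
  zero : ∀ ⦃X Y : C⦄ (f : X ⟶ Y), U X → V Y → f = 0
  exists_triangle : ∀ M, S M → ∃ (A B : C) (f : A ⟶ M) (g : M ⟶ B) (h : B ⟶ A⟦(1 : ℤ)⟧),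
    U A ∧ V B ∧ Triangle.mk f g h ∈ distTriang C

lemma isIso_of_isZero₃ {X Y Z : C} {f : X ⟶ Y} {g : Y ⟶ Z} {h : Z ⟶ X⟦(1 : ℤ)⟧}
    (hT : Triangle.mk f g h ∈ distTriang C) (hZ : IsZero Z) : IsIso f :=
  (Triangle.isZero₃_iff_isIso₁ _ hT).1 hZ

lemma isIso_of_isZero₁ {X Y Z : C} {f : X ⟶ Y} {g : Y ⟶ Z} {h : Z ⟶ X⟦(1 : ℤ)⟧}
    (hT : Triangle.mk f g h ∈ distTriang C) (hX : IsZero X) : IsIso g :=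
  (Triangle.isZero₁_iff_isIso₂ _ hT).1 hX

namespace IsTorsionPair

variable {S U V : ObjectProperty C}

lemma left_of_forall (H : IsTorsionPair S U V) (hU : ∀ X, U X → U (X⟦(1 : ℤ)⟧)) {M : C} (hM : S M)
    (h : ∀ ⦃Y : C⦄ (f : M ⟶ Y), V Y → f = 0) : U M := by
  obtain ⟨A, B, f, g, k, hA, hB, hT⟩ := H.exists_triangle M hM
  obtain ⟨b, hb⟩ := dist_desc₃ hT (𝟙 B) (by rw [h g hB, zero_comp])
  have : IsZero B := by
    rw [IsZero.iff_id_eq_zero, hb, H.zero b (hU A hA) hB, comp_zero]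
  have := isIso_of_isZero₃ hT this
  have := H.left_iso
  exact U.prop_of_iso (asIso f) hA

lemma right_of_forall (H : IsTorsionPair S U V) (hV : ∀ X, V X → V (X⟦(-1 : ℤ)⟧)) {M : C}
    (hM : S M) (h : ∀ ⦃X : C⦄ (f : X ⟶ M), U X → f = 0) : V M := by
  obtain ⟨A, B, f, g, k, hA, hB, hT⟩ := H.exists_triangle M hM
  have : IsZero A := by
    rw [IsZero.iff_id_eq_zero]
    apply (shiftFunctor C (1 : ℤ)).map_injective
    obtain ⟨b, hb⟩ := dist_lift₁ hT (𝟙 (A⟦(1 : ℤ)⟧)) (by rw [h f hA, Functor.map_zero, comp_zero])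
    rw [CategoryTheory.Functor.map_id, Functor.map_zero, hb,
      eq_zero_of_shift (1 : ℤ) (fun g => H.zero g hA (hV B hB)) b, zero_comp]
  have := isIso_of_isZero₁ hT this
  have := H.right_iso
  exact V.prop_of_iso (asIso g).symm hB

/-- A torsion pair whose left part is stable under `⟦1⟧` is a t-structure. -/
theorem exists_tStructure (H : IsTorsionPair ⊤ U V) (hU : ∀ X, U X → U (X⟦(1 : ℤ)⟧))
    (hV : ∀ X, V X → V (X⟦(-1 : ℤ)⟧)) : ∃ t : TStructure C, t.le 0 = U ∧ t.ge 1 = V := by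
  have := H.left_iso
  have := H.right_iso
  let e₀ (X : C) : X⟦(0 : ℤ)⟧ ≅ X := (shiftFunctorZero C ℤ).app X
  have hU' (X : C) (a b c : ℤ) (h : a + b = c) : U (X⟦a⟧⟦b⟧) ↔ U (X⟦c⟧) :=
    U.prop_iff_of_iso ((shiftFunctorAdd' C a b c h).app X).symm
  have hV' (X : C) (a b c : ℤ) (h : a + b = c) : V (X⟦a⟧⟦b⟧) ↔ V (X⟦c⟧) :=
    V.prop_iff_of_iso ((shiftFunctorAdd' C a b c h).app X).symm
  let t : TStructure C :=
    { le := fun n X => U (X⟦n⟧)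
      -- The offset makes `V` the class `ge 1`, which is orthogonal to `le 0`.
      ge := fun n X => V (X⟦n - 1⟧)
      le_isClosedUnderIsomorphisms := fun n =>
        ⟨fun e h => U.prop_of_iso ((shiftFunctor C n).mapIso e) h⟩
      ge_isClosedUnderIsomorphisms := fun n =>
        ⟨fun e h => V.prop_of_iso ((shiftFunctor C (n - 1)).mapIso e) h⟩
      le_shift := fun n a n' h X hX => (hU' X a n' n h).2 hX
      ge_shift := fun n a n' h X hX => (hV' X a (n' - 1) (n - 1) (by lia)).2 hX
      zero' := fun X Y f hX hY => H.zero f (U.prop_of_iso (e₀ X) hX) (V.prop_of_iso (e₀ Y) hY)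
      le_zero_le := fun X hX => (hU' X 0 1 1 (by lia)).1 (hU _ hX)
      ge_one_le := fun X hX => (hV' X 0 (-1) (0 - 1) (by lia)).1 (hV _ hX)
      exists_triangle_zero_one := fun A => by
        obtain ⟨X, Y, f, g, h, hX, hY, hT⟩ := H.exists_triangle A trivial
        exact ⟨X, Y, U.prop_of_iso (e₀ X).symm hX, V.prop_of_iso (e₀ Y).symm hY, f, g, h, hT⟩ }
  refine ⟨t, ?_, ?_⟩
  · ext X
    exact U.prop_iff_of_iso (e₀ X)
  · ext X
    exact V.prop_iff_of_iso (e₀ X)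

/-- A torsion pair with shift stable left part is a t-structure `(U, V)`. -/
theorem isTStructure (H : IsTorsionPair ⊤ U V) (hU : ∀ (n : ℤ) X, U X → U (X⟦n⟧))
    (hV : ∀ (n : ℤ) X, V X → V (X⟦n⟧)) : IsTStructure U V := by
  obtain ⟨t, ht₀, ht₁⟩ := H.exists_tStructure (hU 1) (hV (-1))
  refine ⟨t, ht₀, ?_⟩
  ext X
  have h₁ : t.ge 0 X ↔ t.ge 1 (X⟦(-1 : ℤ)⟧) := by
    rw [← t.shift_ge (-1) 1 0 (by lia)]
    rfl
  rw [h₁, ht₁]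
  refine ⟨fun h => ?_, hV (-1) X⟩
  have := H.right_iso
  exact V.prop_of_iso ((shiftEquiv C (1 : ℤ)).counitIso.app X) (hV 1 _ h)

end IsTorsionPair

/-- A t-structure with shift stable left part is a torsion pair. -/
lemma IsTStructure.isTorsionPair {U V : ObjectProperty C} (h : IsTStructure U V)
    (hU : ∀ (n : ℤ) X, U X → U (X⟦n⟧)) :
    IsTorsionPair ⊤ U V ∧ ∀ (n : ℤ) X, V X → V (X⟦n⟧) := by
  obtain ⟨t, rfl, rfl⟩ := h
  have hle : ∀ n X, t.le 0 X ↔ t.le n X := fun n X => by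
    rw [← t.shift_le n 0 n (by lia)]
    refine ⟨hU n X, fun h => ?_⟩
    exact (t.le 0).prop_of_iso ((shiftEquiv C n).unitIso.app X).symm (hU (-n) _ h)
  have hge : ∀ n X, t.ge 0 X → t.ge n X := fun n X hX => by
    rw [t.ge_iff_isGE, t.isGE_iff_orthogonal (n - 1) n (by lia)]
    intro Y f hY
    -- All the classes `le n` coincide, so `Y` may be placed in degrees at most -1.
    exact t.zero_of_isLE_of_isGE f (-1) 0 (by lia) ⟨(hle _ _).1 ((hle (n - 1) _).2 hY.le)⟩ ⟨hX⟩
  refine ⟨⟨fun _ _ => trivial, fun _ _ => trivial, inferInstance, inferInstance,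
    fun X Y f hX hY => t.zero' f hX (hge 1 _ hY), fun M _ => ?_⟩, fun n X hX => ?_⟩
  · obtain ⟨A, B, hA, hB, f, g, h, hT⟩ := t.exists_triangle_zero_one M
    exact ⟨A, B, f, g, h, hA, t.ge_one_le _ hB, hT⟩
  · exact t.ge_shift n n 0 (by lia) X (hge n X hX)

section FullSubcategory

variable (S : ObjectProperty C) [S.IsTriangulated]

lemma ofFullSubcategory_shift [S.IsClosedUnderIsomorphisms] {U : ObjectProperty S.FullSubcategory}
    [U.IsClosedUnderIsomorphisms] (n : ℤ) (hU : ∀ X, U X → U (X⟦n⟧)) {X : C}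
    (hX : ofFullSubcategory S U X) : ofFullSubcategory S U (X⟦n⟧) := by
  obtain ⟨hX, h⟩ := hX
  exact (ofFullSubcategory S U).prop_of_iso ((S.ι.commShiftIso n).app ⟨X, hX⟩)
    ⟨_, hU _ h⟩

lemma dist_map {E : Type*} [Category* E] [HasZeroObject E] [HasShift E ℤ] [Preadditive E]
    [∀ n : ℤ, (shiftFunctor E n).Additive] [Pretriangulated E] (F : E ⥤ C) [F.CommShift ℤ]
    [F.IsTriangulated] {X Y Z : E} {f : X ⟶ Y} {g : Y ⟶ Z} {h : Z ⟶ X⟦(1 : ℤ)⟧}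
    (hT : Triangle.mk f g h ∈ distTriang E) :
    Triangle.mk (F.map f) (F.map g) (F.map h ≫ (F.commShiftIso (1 : ℤ)).hom.app X) ∈
      distTriang C :=
  F.map_distinguished _ hT

/-- A torsion pair on a full triangulated subcategory. -/
lemma IsTorsionPair.ofFullSubcategory [S.IsClosedUnderIsomorphisms]
    {U V : ObjectProperty S.FullSubcategory} (H : IsTorsionPair ⊤ U V) :
    IsTorsionPair S (ofFullSubcategory S U) (ofFullSubcategory S V) := by
  have := H.left_iso
  have := H.right_iso
  refine ⟨fun _ h => h.1, fun _ h => h.1, inferInstance, inferInstance, ?_, fun M hM => ?_⟩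
  · rintro X Y f ⟨hX, hX'⟩ ⟨hY, hY'⟩
    have := H.zero (X := ⟨X, hX⟩) (Y := ⟨Y, hY⟩) (ObjectProperty.homMk f) hX' hY'
    exact congrArg (fun a => S.ι.map a) this
  · obtain ⟨A, B, f, g, h, hA, hB, hT⟩ := H.exists_triangle ⟨M, hM⟩ trivial
    exact ⟨A.obj, B.obj, _, _, _, ⟨A.property, hA⟩, ⟨B.property, hB⟩, dist_map S.ι hT⟩

end FullSubcategory

end TorsionPair

end TTFRestriction

namespace TTFRestriction

/-! ### Transfer of perfectness along fully faithful functors and truncations. -/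

section PerfectFor

variable {C : Type u} [Category.{v} C]

lemma PerfectFor.mono {T T' : ObjectProperty C} (h : T ≤ T') {ι : Type*} {q : C}
    (hq : PerfectFor T' ι q) : PerfectFor T ι q :=
  fun M N f _ _ hM hN => hq M N f (fun i => h _ (hM i)) (fun i => h _ (hN i))

lemma PerfectFor.surjective_of_isColimit {T : ObjectProperty C} {ι : Type*} {q : C}
    (hq : PerfectFor T ι q) {M N : ι → C} (f : ∀ i, M i ⟶ N i) (hM : ∀ i, T (M i))
    (hN : ∀ i, T (N i)) (hf : ∀ i, Function.Surjective (fun g : q ⟶ M i => g ≫ f i))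
    {c : Cofan M} (hc : IsColimit c) {d : Cofan N} (hd : IsColimit d) (φ : c.pt ⟶ d.pt)
    (hφ : ∀ i, c.inj i ≫ φ = f i ≫ d.inj i) :
    Function.Surjective (fun g : q ⟶ c.pt => g ≫ φ) := by
  have : HasCoproduct M := ⟨⟨c, hc⟩⟩
  have : HasCoproduct N := ⟨⟨d, hd⟩⟩
  let e : ∐ M ⟶ c.pt := Sigma.desc c.inj
  let e' : d.pt ⟶ ∐ N := Cofan.IsColimit.desc hd (Sigma.ι N)
  have he' : e' ≫ Sigma.desc d.inj = 𝟙 _ := Cofan.IsColimit.hom_ext hd _ _ fun i => by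
    rw [← Category.assoc, Cofan.IsColimit.fac, Sigma.ι_desc, Category.comp_id]
  have he : e ≫ φ = Limits.Sigma.map f ≫ Sigma.desc d.inj := by
    ext i
    simp [e, hφ]
  intro y
  obtain ⟨x, hx⟩ := hq M N f hM hN hf (y ≫ e')
  refine ⟨x ≫ e, ?_⟩
  dsimp only at hx ⊢
  rw [Category.assoc, he, ← Category.assoc, hx, Category.assoc, he', Category.comp_id]

lemma PerfectFor.of_equiv {T : ObjectProperty C} {ι κ : Type*} (e : κ ≃ ι) {q : C}
    (hq : PerfectFor T ι q) : PerfectFor T κ q := by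
  intro M N f _ _ hM hN hf
  refine hq.surjective_of_isColimit (M := M ∘ e.symm) (N := N ∘ e.symm) (fun i => f (e.symm i))
    (fun i => hM _) (fun i => hN _) (fun i => hf _)
    (c := Cofan.mk (∐ M) fun i => Sigma.ι M (e.symm i))
    (d := Cofan.mk (∐ N) fun i => Sigma.ι N (e.symm i)) ?_ ?_ (Limits.Sigma.map f) (by simp)
  all_goals exact (Cofan.isColimitEquivOfEquiv _ _).1 (coproductIsCoproduct _)

section FullyFaithful

variable {E : Type*} [Category* E] (F : E ⥤ C) [F.Full] [F.Faithful] {ι : Type*}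
  [HasCoproductsOfShape ι C]

/-- A fully faithful functor reflects coproducts. -/
lemma exists_isColimit_of_essImage {M : ι → E} {N : ι → C} (e : ∀ i, F.obj (M i) ≅ N i) {L : E}
    (a : F.obj L ≅ ∐ N) : ∃ (inj : ∀ i, M i ⟶ L) (_ : IsColimit (Cofan.mk L inj)),
      ∀ i, F.map (inj i) = (e i).hom ≫ Sigma.ι N i ≫ a.inv := by
  refine ⟨fun i => F.preimage ((e i).hom ≫ Sigma.ι N i ≫ a.inv),
    isColimitOfIsColimitCofanMkObj F _ _ ?_, fun i => F.map_preimage _⟩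
  refine Cofan.IsColimit.mk _ (fun s => a.hom ≫ Sigma.desc fun i => (e i).inv ≫ s.inj i) ?_ ?_
  · intro s i
    simp
  · intro s m hm
    rw [← Iso.inv_comp_eq]
    ext i
    rw [Sigma.ι_desc, ← hm i]
    simp

/-- If the ambient coproduct lies in the essential image, full faithfulness makes it a coproduct in
`E` as well, and uniqueness identifies it with the image of `c`. -/
lemma nonempty_isColimit_map {M : ι → E} {c : Cofan M} (hc : IsColimit c)
    (h : F.essImage (∐ fun i => F.obj (M i))) :
    Nonempty (IsColimit (Cofan.mk (F.obj c.pt) fun i => F.map (c.inj i))) := by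
  obtain ⟨L, ⟨a⟩⟩ := h
  obtain ⟨inj, hL, h⟩ := exists_isColimit_of_essImage F (fun i => Iso.refl (F.obj (M i))) a
  let b : c.pt ≅ L := hc.coconePointUniqueUpToIso hL
  have hb : ∀ i, c.inj i ≫ b.hom = inj i := fun i =>
    hc.comp_coconePointUniqueUpToIso_hom hL ⟨i⟩
  refine ⟨IsColimit.ofIsoColimit (coproductIsCoproduct fun i => F.obj (M i))
    (Cofan.ext (F.mapIso b ≪≫ a).symm fun i => ?_)⟩
  rw [Iso.symm_hom, Iso.comp_inv_eq]
  change Sigma.ι (fun i => F.obj (M i)) i = F.map (c.inj i) ≫ F.map b.hom ≫ a.hom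
  rw [← Category.assoc, ← F.map_comp, hb, h]
  simp

/-- The image of a perfect object under a fully faithful functor is perfect with respect to
the families whose coproducts belong to the essential image. -/
lemma PerfectFor.map {p : E} (hp : PerfectFor ⊤ ι p) {B : ObjectProperty C} (hB : B ≤ F.essImage)
    (hB' : ∀ X : ι → C, (∀ i, B (X i)) → F.essImage (∐ X)) : PerfectFor B ι (F.obj p) := by
  intro M N f _ _ hM hN hf y
  choose M' eM using fun i => hB _ (hM i)
  choose N' eN using fun i => hB _ (hN i)
  replace eM := fun i => (eM i).some
  replace eN := fun i => (eN i).some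
  obtain ⟨L, ⟨a⟩⟩ := hB' M hM
  obtain ⟨K, ⟨b⟩⟩ := hB' N hN
  obtain ⟨inj, hL, h⟩ := exists_isColimit_of_essImage F eM a
  obtain ⟨inj', hK, h'⟩ := exists_isColimit_of_essImage F eN b
  obtain ⟨x, hx⟩ := hp.surjective_of_isColimit
    (fun i => F.preimage ((eM i).hom ≫ f i ≫ (eN i).inv)) (fun _ => trivial) (fun _ => trivial)
    (fun i z => by
      obtain ⟨w, hw⟩ := hf i (F.map z ≫ (eN i).hom)
      dsimp only at hw
      refine ⟨F.preimage (w ≫ (eM i).inv), F.map_injective ?_⟩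
      simp [reassoc_of% hw]) hL hK
    (F.preimage (a.hom ≫ Limits.Sigma.map f ≫ b.inv))
    (fun i => F.map_injective (by
      change F.map (inj i ≫ _) = F.map (_ ≫ inj' i)
      simp [h, h'])) (F.preimage (y ≫ b.inv))
  refine ⟨F.map x ≫ a.hom, ?_⟩
  have := congrArg (fun z => F.map z ≫ b.hom) hx
  simpa using this

/-- A fully faithful functor which preserves coproducts reflects perfect objects. -/
lemma PerfectFor.of_map {p : E} (hp : PerfectFor ⊤ ι (F.obj p))
    (hE : ∀ M : ι → E, HasCoproduct M → F.essImage (∐ fun i => F.obj (M i))) :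
    PerfectFor ⊤ ι p := by
  intro M N f _ _ _ _ hf y
  obtain ⟨hc⟩ := nonempty_isColimit_map F (coproductIsCoproduct M) (hE M inferInstance)
  obtain ⟨hd⟩ := nonempty_isColimit_map F (coproductIsCoproduct N) (hE N inferInstance)
  obtain ⟨x, hx⟩ := hp.surjective_of_isColimit (fun i => F.map (f i)) (fun _ => trivial)
    (fun _ => trivial) (fun i z => by
      obtain ⟨w, hw⟩ := hf i (F.preimage z)
      dsimp only at hw
      exact ⟨F.map w, by simp [← F.map_comp, hw]⟩) hc hd (F.map (Limits.Sigma.map f))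
    (fun i => by
      change F.map (Sigma.ι M i) ≫ _ = _ ≫ F.map (Sigma.ι N i)
      rw [← F.map_comp, ← F.map_comp, Sigma.ι_map]) (F.map y)
  refine ⟨F.preimage x, F.map_injective ?_⟩
  simpa using hx

end FullyFaithful

end PerfectFor

section Truncation

variable {C : Type u} [Category.{v} C] [HasZeroObject C] [HasShift C ℤ] [Preadditive C]
  [∀ n : ℤ, (shiftFunctor C n).Additive] [Pretriangulated C]

/-- If there are no morphisms from `q⟦1⟧` to the cone of `f`, then `f` is injective on morphisms
from `q`. -/
lemma dist_eq_zero_of_comp {X Y Z : C} {f : X ⟶ Y} {g : Y ⟶ Z} {h : Z ⟶ X⟦(1 : ℤ)⟧}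
    (hT : Triangle.mk f g h ∈ distTriang C) {q : C} (hq : ∀ a : q⟦(1 : ℤ)⟧ ⟶ Z, a = 0)
    (w : q ⟶ X) (hw : w ≫ f = 0) : w = 0 := by
  apply (shiftFunctor C (1 : ℤ)).map_injective
  obtain ⟨b, hb⟩ := dist_lift₁ hT (w⟦(1 : ℤ)⟧') (by rw [← Functor.map_comp, hw, Functor.map_zero])
  rw [Functor.map_zero, hb, hq b, zero_comp]

/-- Truncation triangles of a retract are retracts of truncation triangles. -/
lemma exists_retract_of_triangles {X Y Z : C} {f : X ⟶ Y} {g : Y ⟶ Z} {h : Z ⟶ X⟦(1 : ℤ)⟧}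
    (hT : Triangle.mk f g h ∈ distTriang C) {X' Y' Z' : C} {f' : X' ⟶ Y'} {g' : Y' ⟶ Z'}
    {h' : Z' ⟶ X'⟦(1 : ℤ)⟧} (hT' : Triangle.mk f' g' h' ∈ distTriang C)
    (h₁ : ∀ a : X ⟶ Z', a = 0) (h₂ : ∀ a : X' ⟶ Z, a = 0) (h₃ : ∀ a : X⟦(1 : ℤ)⟧ ⟶ Z, a = 0)
    (i : Y ⟶ Y') (r : Y' ⟶ Y) (hir : i ≫ r = 𝟙 Y) :
    ∃ (j : X ⟶ X') (s : X' ⟶ X), j ≫ s = 𝟙 X := by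
  obtain ⟨j, hj⟩ := dist_lift₂ hT' (f ≫ i) (h₁ _)
  obtain ⟨s, hs⟩ := dist_lift₂ hT (f' ≫ r) (h₂ _)
  refine ⟨j, s, sub_eq_zero.1 (dist_eq_zero_of_comp hT h₃ _ ?_)⟩
  rw [Preadditive.sub_comp, Category.id_comp, Category.assoc, ← hs, ← Category.assoc, ← hj,
    Category.assoc, hir, Category.comp_id, sub_self]

/-- Surjectivity of `C(q, ∐ M) → C(q, ∐ N)` can be checked after truncation. -/
lemma surjective_map_of_triangles {ι : Type*} [HasCoproductsOfShape ι C] {q : C} {M N : ι → C}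
    (f : ∀ i, M i ⟶ N i) {A B A' B' : ι → C} {a : ∀ i, A i ⟶ M i} {b : ∀ i, M i ⟶ B i}
    {c : ∀ i, B i ⟶ (A i)⟦(1 : ℤ)⟧} (hT : ∀ i, Triangle.mk (a i) (b i) (c i) ∈ distTriang C)
    {a' : ∀ i, A' i ⟶ N i} {b' : ∀ i, N i ⟶ B' i} {c' : ∀ i, B' i ⟶ (A' i)⟦(1 : ℤ)⟧}
    (hT' : ∀ i, Triangle.mk (a' i) (b' i) (c' i) ∈ distTriang C)
    (hAB : ∀ i (g : A i ⟶ B' i), g = 0) (hqB : ∀ i (g : q ⟶ B i), g = 0)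
    (hqB' : ∀ i (g : q⟦(1 : ℤ)⟧ ⟶ B' i), g = 0) (hqS : ∀ g : q ⟶ ∐ B', g = 0)
    (hA : ∀ f' : ∀ i, A i ⟶ A' i, (∀ i, Function.Surjective (fun g : q ⟶ A i => g ≫ f' i)) →
      Function.Surjective (fun g : q ⟶ ∐ A => g ≫ Limits.Sigma.map f'))
    (hf : ∀ i, Function.Surjective (fun g : q ⟶ M i => g ≫ f i)) :
    Function.Surjective (fun g : q ⟶ ∐ M => g ≫ Limits.Sigma.map f) := by
  choose f' hf' using fun i => dist_lift₂ (hT' i) (a i ≫ f i) (hAB i _)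
  intro y
  obtain ⟨k, hk⟩ := exists_coproduct_triangle a' b' c' hT'
  obtain ⟨y', rfl⟩ := dist_lift₂ hk y (hqS _)
  obtain ⟨x, rfl⟩ := hA f' (fun i z => by
    obtain ⟨w, hw⟩ := hf i (z ≫ a' i)
    obtain ⟨u, rfl⟩ := dist_lift₂ (hT i) w (hqB i _)
    refine ⟨u, sub_eq_zero.1 (dist_eq_zero_of_comp (hT' i) (hqB' i) _ ?_)⟩
    dsimp only at hw ⊢
    rw [Preadditive.sub_comp, ← hw, Category.assoc, Category.assoc, hf', sub_self]) y'
  refine ⟨x ≫ Limits.Sigma.map a, ?_⟩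
  have : Limits.Sigma.map a ≫ Limits.Sigma.map f = Limits.Sigma.map f' ≫ Limits.Sigma.map a' := by
    ext i
    have := congrArg (fun z => z ≫ Sigma.ι N i) (hf' i)
    simpa using this
  dsimp only
  rw [Category.assoc, this, Category.assoc]

end Truncation

end TTFRestriction

namespace TTFRestriction

lemma ClosedUnderCoproducts.sigma {C : Type u} [Category.{v} C] {T : ObjectProperty C}
    (hT : ClosedUnderCoproducts T) {ι : Type v} {X : ι → C} [HasCoproduct X]
    (hX : ∀ i, T (X i)) : T (∐ X) :=
  have := hT ι
  T.prop_colimit (Discrete.functor X) fun i => hX i.as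

lemma ClosedUnderCoproducts.sigma_nat {C : Type u} [Category.{v} C] {T : ObjectProperty C}
    (hT : ClosedUnderCoproducts T) {X : ℕ → C} [HasCoproduct X] (hX : ∀ i, T (X i)) : T (∐ X) :=
  have := hT (ULift.{v} ℕ)
  have := ObjectProperty.IsClosedUnderColimitsOfShape.of_equivalence (P := T)
    (Discrete.equivalence Equiv.ulift : Discrete (ULift.{v} ℕ) ≌ Discrete ℕ)
  T.prop_colimit (Discrete.functor X) fun i => hX i.as

lemma isClosedUnderColimitsOfShape_of_sigma {C : Type u} [Category.{v} C] {T : ObjectProperty C}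
    [T.IsClosedUnderIsomorphisms] {J : Type*}
    (hT : ∀ (X : J → C) [HasCoproduct X], (∀ i, T (X i)) → T (∐ X)) :
    T.IsClosedUnderColimitsOfShape (Discrete J) := by
  refine ⟨fun X ⟨c⟩ => ?_⟩
  have : HasColimit c.diag := ⟨⟨⟨_, c.isColimit⟩⟩⟩
  have : HasCoproduct fun j => c.diag.obj ⟨j⟩ := hasColimit_of_iso Discrete.natIsoFunctor.symm
  refine T.prop_of_iso ?_ (hT (fun j => c.diag.obj ⟨j⟩) fun j => c.prop_diag_obj ⟨j⟩)
  exact HasColimit.isoOfNatIso Discrete.natIsoFunctor.symm ≪≫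
    (colimit.isColimit _).coconePointUniqueUpToIso c.isColimit

/-! ### Families of objects bounded above. -/

section BoundedAbove

variable {C : Type u} [Category.{v} C] [HasZeroObject C] [HasShift C ℤ] [Preadditive C]
  [∀ n : ℤ, (shiftFunctor C n).Additive] [Pretriangulated C] (t : TStructure C)

lemma isLE_sigma {ι : Type*} {X : ι → C} [HasCoproduct X] {n : ℤ} (hX : ∀ i, t.IsLE (X i) n) :
    t.IsLE (∐ X) n := by
  rw [t.isLE_iff_orthogonal n (n + 1) rfl]
  intro Y f hY
  ext i
  rw [t.zero_of_isLE_of_isGE (Sigma.ι X i ≫ f) n (n + 1) (by lia) (hX i) hY, comp_zero]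

lemma isLE_of_retract {X Y : C} {i : X ⟶ Y} {r : Y ⟶ X} (h : i ≫ r = 𝟙 X) {n : ℤ}
    (hY : t.IsLE Y n) : t.IsLE X n := by
  rw [t.isLE_iff_orthogonal n (n + 1) rfl]
  intro Z f hZ
  rw [← Category.id_comp f, ← h, Category.assoc, t.zero (r ≫ f) n (n + 1) (by lia), comp_zero]

lemma sigma_ι_retract {C : Type*} [Category* C] [HasZeroMorphisms C] {ι : Type*} (X : ι → C)
    [HasCoproduct X] (i : ι) : ∃ r : ∐ X ⟶ X i, Sigma.ι X i ≫ r = 𝟙 _ := by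
  classical
  exact ⟨Limits.Sigma.π X i, Sigma.ι_π_eq_id X i⟩

lemma closedUnderCoproducts_ge [HasCoproducts.{v} C] (h : ClosedUnderCoproducts (t.ge 1)) (n : ℤ) :
    ClosedUnderCoproducts (t.ge n) := fun J => by
  have := h J
  rw [← t.shift_ge (n - 1) 1 n (by lia)]
  exact inferInstanceAs
    (((t.ge 1).inverseImage (shiftFunctor C (n - 1))).IsClosedUnderColimitsOfShape _)

lemma exists_isLE_of_dist {X Y Z : C} {f : X ⟶ Y} {g : Y ⟶ Z} {h : Z ⟶ X⟦(1 : ℤ)⟧}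
    (hT : Triangle.mk f g h ∈ distTriang C) {m n : ℤ} (hX : t.IsLE X m) (hY : t.IsLE Y n) :
    t.IsLE Z (max m n) := by
  have := t.isLE_shift X m 1 (m - 1)
  exact t.isLE₂ _ (rot_of_distTriang _ hT) _ (t.isLE_of_le Y n _)
    (t.isLE_of_le (X⟦(1 : ℤ)⟧) (m - 1) _)

/-- An object bounded above by `m` is perfect if it is perfect with respect to families of objects
bounded above by `m`. -/
lemma PerfectFor.top_of_isLE {ι : Type v} [HasCoproducts.{v} C]
    (h : ClosedUnderCoproducts (t.ge 1)) {q : C} {m : ℤ} (hqm : t.IsLE q m)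
    (hq : PerfectFor (t.le m) ι q) : PerfectFor ⊤ ι q := by
  intro M N f _ _ _ _ hf
  choose A B hA hB a b c hT using fun i => t.exists_triangle (M i) m (m + 1) rfl
  choose A' B' hA' hB' a' b' c' hT' using fun i => t.exists_triangle (N i) m (m + 1) rfl
  have hS : t.ge (m + 1) (∐ B') := (closedUnderCoproducts_ge t h (m + 1)).sigma hB'
  have := t.isLE_shift q m 1 (m - 1)
  exact surjective_map_of_triangles f hT hT'
    (fun i g => t.zero_of_isLE_of_isGE g m (m + 1) (by lia) ⟨hA i⟩ ⟨hB' i⟩)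
    (fun i g => t.zero_of_isLE_of_isGE g m (m + 1) (by lia) hqm ⟨hB i⟩)
    (fun i g => t.zero_of_isLE_of_isGE g (m - 1) (m + 1) (by lia) this ⟨hB' i⟩)
    (fun g => t.zero_of_isLE_of_isGE g m (m + 1) (by lia) hqm ⟨hS⟩)
    (fun f' hf' => hq A A' f' hA hA' hf') hf

variable {t} {X Y Z : ObjectProperty C}

lemma IsTorsionPair.left_sigma (H : IsTorsionPair t.minus X Y)
    (hX : ∀ (n : ℤ) A, X A → X (A⟦n⟧)) {ι : Type*} {A : ι → C} [HasCoproduct A]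
    (hA : ∀ i, X (A i)) {n : ℤ} (hn : ∀ i, t.IsLE (A i) n) : X (∐ A) :=
  H.left_of_forall (hX 1) ⟨n, isLE_sigma t hn⟩ fun B f hB => by
    ext i
    rw [H.zero (Sigma.ι A i ≫ f) (hA i) hB, comp_zero]

/-- Truncation of a family with respect to a torsion pair on the objects bounded above. -/
lemma IsTorsionPair.exists_bounded_triangles (H : IsTorsionPair t.minus X Y)
    (hX : ∀ (n : ℤ) A, X A → X (A⟦n⟧)) {ι : Type*} {M : ι → C} [HasCoproduct M] {n : ℤ}
    (hM : ∀ i, t.IsLE (M i) n) :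
    ∃ (m : ℤ) (A B : ι → C) (a : ∀ i, A i ⟶ M i) (b : ∀ i, M i ⟶ B i)
      (c : ∀ i, B i ⟶ (A i)⟦(1 : ℤ)⟧), (∀ i, X (A i)) ∧ (∀ i, Y (B i)) ∧
      (∀ i, t.IsLE (A i) m) ∧ (∀ i, t.IsLE (B i) m) ∧
      ∀ i, Triangle.mk (a i) (b i) (c i) ∈ distTriang C := by
  obtain ⟨A₀, B₀, f, g, h, hA₀, hB₀, hT₀⟩ := H.exists_triangle (∐ M) ⟨n, isLE_sigma t hM⟩
  obtain ⟨m, hm⟩ := H.left_le _ hA₀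
  choose A B a b c hA hB hT using fun i => H.exists_triangle (M i) ⟨n, hM i⟩
  -- The bound `m` belongs to the truncation `A₀` of `∐ M`. As `M i` is a retract of `∐ M`, its
  -- truncation is a retract of `A₀`, so `m` serves for all `i`.
  have hAm : ∀ i, t.IsLE (A i) m := fun i => by
    obtain ⟨r, hr⟩ := sigma_ι_retract M i
    obtain ⟨j, s, hjs⟩ := exists_retract_of_triangles (hT i) hT₀ (fun x => H.zero x (hA i) hB₀)
      (fun x => H.zero x hA₀ (hB i)) (fun x => H.zero x (hX 1 _ (hA i)) (hB i)) _ r hr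
    exact isLE_of_retract t hjs hm
  exact ⟨max m n, A, B, a, b, c, hA, hB, fun i => t.isLE_of_le _ m _,
    fun i => exists_isLE_of_dist t (hT i) (hAm i) (hM i), hT⟩

/-- An object which is perfect with respect to bounded families in the first term of a TTF triple
on the objects bounded above is perfect with respect to all bounded families. -/
lemma PerfectFor.of_isTorsionPair {ι : Type*} [HasCoproductsOfShape ι C]
    (H₁ : IsTorsionPair t.minus X Y) (H₂ : IsTorsionPair t.minus Y Z)
    (hX : ∀ (n : ℤ) A, X A → X (A⟦n⟧)) (hY : ∀ (n : ℤ) A, Y A → Y (A⟦n⟧)) {q : C} (hqX : X q)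
    (hq : ∀ n, PerfectFor (X ⊓ t.le n) ι q) (n : ℤ) : PerfectFor (t.le n) ι q := by
  intro M N f _ _ hM hN hf
  obtain ⟨m, A, B, a, b, c, hA, hB, hAm, hBm, hT⟩ :=
    H₁.exists_bounded_triangles hX (fun i => ⟨hM i⟩)
  obtain ⟨m', A', B', a', b', c', hA', hB', hAm', hBm', hT'⟩ :=
    H₁.exists_bounded_triangles hX (fun i => ⟨hN i⟩)
  exact surjective_map_of_triangles f hT hT' (fun i g => H₁.zero g (hA i) (hB' i))
    (fun i g => H₁.zero g hqX (hB i)) (fun i g => H₁.zero g (hX 1 _ hqX) (hB' i))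
    -- This is where `(Y, Z)` enters: as a left part, `Y` contains the coproduct of the uniformly
    -- bounded `B' i`.
    (fun g => H₁.zero g hqX (H₂.left_sigma hY hB' hBm'))
    (fun f' hf' => hq (max m m') A A' f'
      (fun i => ⟨hA i, t.le_monotone (le_max_left m m') _ (hAm i).le⟩)
      (fun i => ⟨hA' i, t.le_monotone (le_max_right m m') _ (hAm' i).le⟩) hf') hf

end BoundedAbove

end TTFRestriction

namespace TTFRestriction

lemma closedUnderCoproducts_leftOrthogonal {C : Type u} [Category.{v} C] [HasZeroMorphisms C]
    (V : ObjectProperty C) :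
    ClosedUnderCoproducts V.leftOrthogonal := fun _ => ⟨fun _ ⟨c⟩ _ f hY =>
  c.isColimit.hom_ext fun j => by
    rw [comp_zero]
    exact c.prop_diag_obj j _ hY⟩

/-! ### Localizing subcategories generated by perfect objects. -/

section Tria

variable {C : Type u} [Category.{v} C] [HasZeroObject C] [HasShift C ℤ] [Preadditive C]
  [∀ n : ℤ, (shiftFunctor C n).Additive] [Pretriangulated C]

instance (Q : ObjectProperty C) : (tria Q).IsClosedUnderIsomorphisms where
  of_iso e h T h₁ h₂ h₃ h₄ := T.prop_of_iso e (h T h₁ h₂ h₃ h₄)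

instance (Q : ObjectProperty C) : (tria Q).IsTriangulated where
  exists_zero := ⟨_, isZero_zero C, fun T _ _ _ _ => T.prop_zero⟩
  isStableUnderShiftBy n :=
    { le_shift := fun X hX T h₁ h₂ h₃ h₄ => T.le_shift n X (hX T h₁ h₂ h₃ h₄) }
  ext₂' A hA hA₁ hA₃ := ObjectProperty.le_isoClosure _ _ fun T h₁ h₂ h₃ h₄ =>
    T.ext_of_isTriangulatedClosed₂ A hA (hA₁ T h₁ h₂ h₃ h₄) (hA₃ T h₁ h₂ h₃ h₄)

lemma closedUnderCoproducts_tria (Q : ObjectProperty C) : ClosedUnderCoproducts (tria Q) :=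
  fun J => ⟨fun _ ⟨c⟩ T h₁ h₂ h₃ h₄ =>
    (h₃ J).colimitsOfShape_le _ ⟨c.ofLE fun _ h => h T h₁ h₂ h₃ h₄⟩⟩

lemma le_tria (Q : ObjectProperty C) : Q ≤ tria Q := fun _ hX _ _ _ _ h => h _ hX

lemma rightOrthogonal_tria_iff {K : Type*} (p : K → C) (B : C) :
    (tria (ObjectProperty.ofObj p)).rightOrthogonal B ↔ ∀ k (n : ℤ) (f : (p k)⟦n⟧ ⟶ B), f = 0 := by
  refine ⟨fun h k n f => h f ((tria _).le_shift n _ (le_tria _ _ ⟨k⟩)), fun h => ?_⟩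
  -- The shifts of `B` form a shift-stable class, so its left orthogonal is localizing; it contains
  -- the `p k` and hence `tria`.
  let W : ObjectProperty C := fun Y => ∃ n : ℤ, Nonempty (Y ≅ B⟦-n⟧)
  have : W.IsStableUnderShift ℤ :=
    { isStableUnderShiftBy := fun a =>
        { le_shift := fun Y ⟨n, ⟨e⟩⟩ => ⟨n - a, ⟨(shiftFunctor C a).mapIso e ≪≫
            ((shiftFunctorAdd' C (-n) a (-(n - a)) (by lia)).app B).symm⟩⟩ } }
  intro X f hX
  refine hX W.leftOrthogonal inferInstance inferInstance
    (closedUnderCoproducts_leftOrthogonal W) ?_ f ⟨0, ⟨?_⟩⟩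
  · rintro _ ⟨k⟩ Y g ⟨n, ⟨e⟩⟩
    rw [← cancel_mono e.hom, zero_comp]
    exact eq_zero_of_unshift n (h k n) _
  · exact ((shiftFunctorZero' C (-0 : ℤ) (by lia)).app B).symm

lemma PerfectFor.sigma_eq_zero {ι : Type*} [HasCoproductsOfShape ι C] {q : C}
    (hq : PerfectFor ⊤ ι q) {Y : ι → C} (hY : ∀ i (f : q ⟶ Y i), f = 0) (f : q ⟶ ∐ Y) : f = 0 := by
  have := hq.comp_map_eq_zero (fun i => 𝟙 (Y i)) (fun _ => trivial) (fun _ => trivial)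
    (fun i g => by rw [hY i g, zero_comp]) f
  simpa using this

variable [HasCoproducts.{v} C]

/-- The localizing subcategory generated by a set of perfect objects is the left part of a torsion
pair. -/
theorem isTorsionPair_tria [HasCoproductsOfShape ℕ C] {K : Type v} (p : K → C)
    (hp : ∀ k, PerfectFor (tria (ObjectProperty.ofObj p)) ℕ (p k)) :
    IsTorsionPair ⊤ (tria (ObjectProperty.ofObj p))
      (tria (ObjectProperty.ofObj p)).rightOrthogonal := by
  refine ⟨fun _ _ => trivial, fun _ _ => trivial, inferInstance, inferInstance,
    fun X Y f hX hY => hY f hX, fun M _ => ?_⟩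
  obtain ⟨A, B, f, g, h, hA, hB, hT⟩ := exists_triangle_of_perfectFor
    (T := tria (ObjectProperty.ofObj p))
    (fun ι X hX => (closedUnderCoproducts_tria _).sigma hX)
    (fun X hX => (closedUnderCoproducts_tria _).sigma_nat hX)
    -- All integer shifts are included so that the family is closed under desuspension.
    (K := K × ULift.{v} ℤ) (fun k => (p k.1)⟦k.2.down⟧)
    (fun k => (tria _).le_shift _ _ (le_tria _ _ ⟨k.1⟩)) (fun k => (hp k.1).shift _)
    (fun k => ⟨(k.1, ⟨k.2.down + -1⟩), ⟨(shiftFunctorAdd C k.2.down (-1)).app (p k.1)⟩⟩) M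
  exact ⟨A, B, f, g, h, hA, (rightOrthogonal_tria_iff p B).2 fun k n x => hB (k, ⟨n⟩) x, hT⟩

lemma closedUnderCoproducts_rightOrthogonal_tria {K : Type*} (p : K → C)
    (hp : ∀ k (ι : Type v), PerfectFor ⊤ ι (p k)) :
    ClosedUnderCoproducts (tria (ObjectProperty.ofObj p)).rightOrthogonal :=
  fun ι => isClosedUnderColimitsOfShape_of_sigma fun Y _ hY => by
    rw [rightOrthogonal_tria_iff]
    intro k n f
    exact ((hp k ι).shift n).sigma_eq_zero
      (fun i g => (rightOrthogonal_tria_iff p (Y i)).1 (hY i) k n g) f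


end Tria

end TTFRestriction

namespace TTFRestriction

/-! ### Extension of the TTF triple to the whole category. -/

section Extension

variable {C : Type u} [Category.{v} C] [HasZeroObject C] [HasShift C ℤ] [Preadditive C]
  [∀ n : ℤ, (shiftFunctor C n).Additive] [Pretriangulated C]

/-- Reflecting a perfect object `q` into the right part `Y` of a decomposition gives an object which
is perfect with respect to families in `Y`. -/
lemma PerfectFor.of_dist {ι : Type*} {T Y : ObjectProperty C} (hYT : Y ≤ T) {X q y : C}
    {a : X ⟶ q} {b : q ⟶ y} {c : y ⟶ X⟦(1 : ℤ)⟧} (hT : Triangle.mk a b c ∈ distTriang C)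
    (h : ∀ B, Y B → ∀ f : X ⟶ B, f = 0) (h' : ∀ B, Y B → ∀ f : X⟦(1 : ℤ)⟧ ⟶ B, f = 0)
    [HasCoproductsOfShape ι C] (hY : ∀ B : ι → C, (∀ i, Y (B i)) → Y (∐ B))
    (hq : PerfectFor T ι q) : PerfectFor Y ι y := by
  intro M N f _ _ hM hN hf z
  obtain ⟨w, hw⟩ := hq M N f (fun i => hYT _ (hM i)) (fun i => hYT _ (hN i)) (fun i g => by
    obtain ⟨g', rfl⟩ := dist_desc₂ hT g (h _ (hN i) _)
    obtain ⟨u, rfl⟩ := hf i g'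
    exact ⟨b ≫ u, Category.assoc _ _ _⟩) (b ≫ z)
  obtain ⟨x, rfl⟩ := dist_desc₂ hT w (h _ (hY M hM) _)
  refine ⟨x, sub_eq_zero.1 ?_⟩
  dsimp only at hw ⊢
  obtain ⟨k, hk⟩ := dist_desc₃ hT (x ≫ Limits.Sigma.map f - z) (by
    rw [Preadditive.comp_sub, ← Category.assoc, hw, sub_self])
  rw [hk, h' _ (hY N hN) k, comp_zero]

variable [HasCoproducts.{v} C] [HasCoproductsOfShape ℕ C] {I : Type v} {Q : I → C}
  {K : Type v} {p : K → C}

/-- The right orthogonal of a localizing subcategory generated by superperfect objects is again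
generated by perfect objects, the reflections of the generators of `C`. -/
theorem rightOrthogonal_tria_eq_tria (hQ : ∀ i, PerfectFor ⊤ ℕ (Q i))
    (hQgen : Generates (ObjectProperty.ofObj Q)) (hp : ∀ k (ι : Type v), PerfectFor ⊤ ι (p k))
    {x y : I → C} {a : ∀ i, x i ⟶ Q i} {b : ∀ i, Q i ⟶ y i} {c : ∀ i, y i ⟶ (x i)⟦(1 : ℤ)⟧}
    (hx : ∀ i, tria (ObjectProperty.ofObj p) (x i))
    (hy : ∀ i, (tria (ObjectProperty.ofObj p)).rightOrthogonal (y i))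
    (hT : ∀ i, Triangle.mk (a i) (b i) (c i) ∈ distTriang C) :
    (tria (ObjectProperty.ofObj p)).rightOrthogonal = tria (ObjectProperty.ofObj y) ∧
    IsTorsionPair ⊤ (tria (ObjectProperty.ofObj y))
      (tria (ObjectProperty.ofObj y)).rightOrthogonal := by
  have hYc := closedUnderCoproducts_rightOrthogonal_tria p hp
  have hle : tria (ObjectProperty.ofObj y) ≤ (tria (ObjectProperty.ofObj p)).rightOrthogonal :=
    fun M hM => hM _ inferInstance inferInstance hYc (by rintro _ ⟨i⟩; exact hy i)
  -- The `y i` are only known to be perfect for families in `tria(p)^⊥`, which is why the relative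
  -- form of Brown representability is needed.
  have H := isTorsionPair_tria y fun i => PerfectFor.mono hle
    (PerfectFor.of_dist le_top (hT i) (fun B hB f => hB f (hx i))
      (fun B hB f => hB f ((tria _).le_shift 1 _ (hx i))) (fun B hB => hYc.sigma_nat hB) (hQ i))
  refine ⟨le_antisymm (fun M hM => ?_) hle, H⟩
  obtain ⟨A, B, f, g, h, hA, hB, hT'⟩ := H.exists_triangle M trivial
  have hB' : (tria (ObjectProperty.ofObj p)).rightOrthogonal B :=
    ObjectProperty.ext_of_isTriangulatedClosed₃ _ _ hT' (hle _ hA) hM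
  -- `B` is right orthogonal to the shifts of both `x i` and `y i`, hence to those of their
  -- extension `Q i`.
  have : IsZero B := hQgen B (by
    rintro _ ⟨i⟩ n e
    refine eq_zero_of_shift n (fun e' => ?_) e
    obtain ⟨e'', rfl⟩ := dist_desc₂ (hT i) e'
      (ObjectProperty.le_shift _ (-n) _ hB' _ (hx i))
    rw [ObjectProperty.le_shift _ (-n) _ hB e'' (le_tria _ _ ⟨i⟩), comp_zero])
  have := isIso_of_isZero₃ hT' this
  exact (tria _).prop_of_iso (asIso f) hA

variable {t : TStructure C} {X Y Z : ObjectProperty C}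

/-- Extension of a TTF triple from the objects bounded above to the whole category. -/
theorem exists_extension (hQ : ∀ i, PerfectFor ⊤ ℕ (Q i))
    (hQgen : Generates (ObjectProperty.ofObj Q)) (hQt : ∀ i, t.minus (Q i))
    (H₁ : IsTorsionPair t.minus X Y) (H₂ : IsTorsionPair t.minus Y Z)
    (hX : ∀ (n : ℤ) A, X A → X (A⟦n⟧)) (hY : ∀ (n : ℤ) A, Y A → Y (A⟦n⟧))
    (hZ : ∀ (n : ℤ) A, Z A → Z (A⟦n⟧))
    (hp : ∀ k (ι : Type v), PerfectFor ⊤ ι (p k)) (hpX : ∀ k, X (p k))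
    (hXp : X ≤ tria (ObjectProperty.ofObj p)) :
    ∃ S : TTFTriple C, S.X = tria (ObjectProperty.ofObj p) ∧
      S.Y = (tria (ObjectProperty.ofObj p)).rightOrthogonal ∧
      S.Z = (tria (ObjectProperty.ofObj p)).rightOrthogonal.rightOrthogonal ∧
      ∀ M, t.minus M → (S.X M ↔ X M) ∧ (S.Y M ↔ Y M) ∧ (S.Z M ↔ Z M) := by
  have hYp : Y ≤ (tria (ObjectProperty.ofObj p)).rightOrthogonal := fun M hM => by
    rw [rightOrthogonal_tria_iff]
    exact fun k n f => H₁.zero f (hX n _ (hpX k)) hM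
  -- Truncating inside the bounded objects puts `y i` in the original `Y`. Then any object of `Z` is
  -- orthogonal to the generators of `tria(p)^⊥`, so `Z` lies in the third term of the extended
  -- triple.
  choose x y a b c hx hy hT using fun i => H₁.exists_triangle (Q i) (hQt i)
  obtain ⟨hYy, K₂⟩ := rightOrthogonal_tria_eq_tria hQ hQgen hp (fun i => hXp _ (hx i))
    (fun i => hYp _ (hy i)) hT
  have K₁ := isTorsionPair_tria p fun k =>
    ((hp k _).of_equiv (Equiv.ulift (α := ℕ)).symm).mono le_top
  have hYs (n : ℤ) (A : C) : (tria (ObjectProperty.ofObj p)).rightOrthogonal A →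
    (tria (ObjectProperty.ofObj p)).rightOrthogonal (A⟦n⟧) := ObjectProperty.le_shift _ n A
  have hZs (n : ℤ) (A : C) :
      (tria (ObjectProperty.ofObj p)).rightOrthogonal.rightOrthogonal A →
      (tria (ObjectProperty.ofObj p)).rightOrthogonal.rightOrthogonal (A⟦n⟧) :=
    ObjectProperty.le_shift _ n A
  rw [← hYy] at K₂
  refine ⟨⟨_, _, _, K₁.isTStructure (fun n => ObjectProperty.le_shift _ n) hYs,
    K₂.isTStructure hYs hZs⟩, rfl, rfl, rfl, fun M hM => ⟨⟨fun h => ?_, hXp M⟩,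
      ⟨fun h => ?_, hYp M⟩, ⟨fun h => ?_, fun h => ?_⟩⟩⟩
  · obtain ⟨A, B, f, g, k, hA, hB, hT'⟩ := H₁.exists_triangle M hM
    have hB' : tria (ObjectProperty.ofObj p) B :=
      ObjectProperty.ext_of_isTriangulatedClosed₃ _ _ hT' (hXp _ hA) h
    have : IsZero B := (IsZero.iff_id_eq_zero B).2 (hYp B hB (𝟙 B) hB')
    have := isIso_of_isZero₃ hT' this
    have := H₁.left_iso
    exact X.prop_of_iso (asIso f) hA
  · exact H₁.right_of_forall (hY (-1)) hM fun A f hA => h f (hXp A hA)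
  · exact H₂.right_of_forall (hZ (-1)) hM fun A f hA => h f (hYp A hA)
  · change (tria (ObjectProperty.ofObj p)).rightOrthogonal.rightOrthogonal M
    rw [hYy, rightOrthogonal_tria_iff]
    exact fun i n f => H₂.zero f (hY n _ (hy i)) h

end Extension

end TTFRestriction

namespace TTFRestriction

/-! ### The aisle of `Q`, its bounded objects, and exhaustive generation. -/

section Aisle

variable {C : Type u} [Category.{v} C] [HasZeroObject C] [HasShift C ℤ] [Preadditive C]
  [∀ n : ℤ, (shiftFunctor C n).Additive] [Pretriangulated C]

/-- The aisle generated by a set of perfect objects. -/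
theorem exists_tStructure_of_perfect [HasCoproducts.{v} C] [HasCoproductsOfShape ℕ C] {I : Type v}
    (Q : I → C) (hQ : ∀ i, PerfectFor ⊤ ℕ (Q i)) :
    ∃ t : TStructure C, t.le 0 = aisle (ObjectProperty.ofObj Q) := by
  -- Only nonnegative shifts are used: their right orthogonal is stable under `⟦-1⟧`, which gives a
  -- t-structure instead of a localizing subcategory.
  let q : I × ULift.{v} ℕ → C := fun k => (Q k.1)⟦(k.2.down : ℤ)⟧
  let V : ObjectProperty C := fun M => ∀ k (f : q k ⟶ M), f = 0
  have hV : ∀ M, V M → V (M⟦(-1 : ℤ)⟧) := by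
    rintro M hM ⟨i, ⟨n⟩⟩ f
    refine eq_zero_of_unshift 1 (fun b => ?_) f
    have e := (shiftFunctorAdd' C (n : ℤ) 1 ((n + 1 : ℕ) : ℤ) (by simp)).app (Q i)
    rw [← cancel_epi e.hom, comp_zero]
    exact hM (i, ⟨n + 1⟩) _
  have H : IsTorsionPair ⊤ V.leftOrthogonal V :=
    ⟨fun _ _ => trivial, fun _ _ => trivial, inferInstance,
      ⟨fun e h k f => by rw [← cancel_mono e.inv, zero_comp]; exact h k _⟩,
      fun A B f hA hB => hA f hB, fun M _ => exists_triangle_of_perfect q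
        (fun k => (hQ k.1).shift _) V (fun _ => Iff.rfl) hV M⟩
  obtain ⟨t, ht₀, -⟩ := H.exists_tStructure
    (fun A hA B f hB => eq_zero_of_shift 1 (fun g => hA g (hV B hB)) f) hV
  refine ⟨t, eq_aisle_of_isLeast ⟨⟨⟨t, rfl⟩, ?_⟩, ?_⟩⟩
  · rw [ht₀]
    rintro _ ⟨i⟩ B f hB
    have e := (shiftFunctorZero' C ((0 : ℕ) : ℤ) (by simp)).app (Q i)
    rw [← cancel_epi e.hom, comp_zero]
    exact hB (i, ⟨0⟩) _
  · rintro _ ⟨⟨s, rfl⟩, hs⟩ A hA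
    rw [ht₀] at hA
    rw [s.le_iff_isLE, s.isLE_iff_orthogonal 0 1 (by lia)]
    intro B f hB
    refine hA f fun k g => ?_
    have := s.le_shift 0 k.2.down (-k.2.down) (by lia) _ (hs _ ⟨k.1⟩)
    exact s.zero_of_isLE_of_isGE g (-k.2.down) 1 (by lia) ⟨this⟩ hB

lemma ge_one_eq_rightOrthogonal (t : TStructure C) : t.ge 1 = (t.le 0).rightOrthogonal := by
  ext X
  rw [t.ge_iff_isGE, t.isGE_iff_orthogonal 0 1 (by lia)]
  exact ⟨fun h Y f hY => h Y f ⟨hY⟩, fun h Y f hY => h f hY.le⟩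

lemma unionOfShifts_eq_minus (t : TStructure C) : unionOfShifts (t.le 0) = t.minus := by
  ext X
  constructor
  · rintro ⟨n, Y, hY, ⟨e⟩⟩
    have : t.IsLE (Y⟦n⟧) (-n) := ⟨t.le_shift 0 n (-n) (by lia) Y hY⟩
    exact ⟨-n, t.isLE_of_iso e.symm (-n)⟩
  · rintro ⟨n, hn⟩
    exact ⟨-n, X⟦n⟧, t.le_shift n n 0 (by lia) X hn.le, ⟨(shiftEquiv C n).unitIso.app X⟩⟩

end Aisle

/-- The inverse image under a fully faithful functor of a class of objects closed under coproducts
is closed under coproducts. -/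
lemma isClosedUnderColimitsOfShape_inverseImage {C : Type u} [Category.{v} C]
    {E : Type*} [Category E] (F : E ⥤ C)
    [F.Full] [F.Faithful] {J : Type*} [HasCoproductsOfShape J C]
    (hF : ∀ M : J → E, HasCoproduct M → F.essImage (∐ fun i => F.obj (M i)))
    (T : ObjectProperty C) [T.IsClosedUnderIsomorphisms]
    (hT : ∀ X : J → C, (∀ i, T (X i)) → T (∐ X)) :
    (T.inverseImage F).IsClosedUnderColimitsOfShape (Discrete J) :=
  isClosedUnderColimitsOfShape_of_sigma fun M _ hM => by
    obtain ⟨hc⟩ := nonempty_isColimit_map F (coproductIsCoproduct M) (hF M inferInstance)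
    exact T.prop_of_iso ((coproductIsCoproduct _).coconePointUniqueUpToIso hc)
      (hT (fun i => F.obj (M i)) hM)

section BoundedCoproducts

variable {C : Type u} [Category.{v} C] [HasZeroObject C] [HasShift C ℤ] [Preadditive C]
  [∀ n : ℤ, (shiftFunctor C n).Additive] [Pretriangulated C] {t : TStructure C}

/-- Each summand is a retract of the coproduct, so the mere existence of a coproduct of bounded
objects forces a uniform bound on the family. -/
lemma isLE_of_hasCoproduct {E : Type*} [Category* E] [HasZeroMorphisms E] (F : E ⥤ C) {ι : Type*}
    (M : ι → E) [HasCoproduct M] {n : ℤ} (h : t.IsLE (F.obj (∐ M)) n) (i : ι) :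
    t.IsLE (F.obj (M i)) n := by
  obtain ⟨r, hr⟩ := sigma_ι_retract M i
  refine isLE_of_retract t (i := F.map (Sigma.ι M i)) (r := F.map r) ?_ h
  rw [← F.map_comp, hr, F.map_id]

lemma finiteExtensions_le {Q W : ObjectProperty C} [W.IsTriangulated]
    [W.IsClosedUnderIsomorphisms] (h : Q ≤ W) : finiteExtensions Q ≤ W := by
  rintro X (hX | ⟨n, hX⟩)
  · exact W.prop_of_isZero hX
  · exact ObjectProperty.extensionProductIter_le_of_isTriangulatedClosed₂ Q h n X hX

/-- Objects of an exhaustively generated category `E` belong to the localizing subcategory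
generated by the generators of `E`. -/
lemma ExhaustivelyGeneratedToTheLeft.map_tria [HasCoproducts.{v} C] [HasCoproductsOfShape ℕ C]
    {E : Type u} [Category.{v} E] [HasZeroObject E] [HasShift E ℤ] [Preadditive E]
    [∀ n : ℤ, (shiftFunctor E n).Additive] [Pretriangulated E] (F : E ⥤ C) [F.Full] [F.Faithful]
    [F.CommShift ℤ] [F.IsTriangulated] {K : Type*} {P : K → E}
    (hP : ExhaustivelyGeneratedToTheLeft (ObjectProperty.ofObj P))
    (hF : ∀ (J : Type v) (M : J → E), HasCoproduct M → F.essImage (∐ fun i => F.obj (M i)))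
    (hFN : ∀ M : ℕ → E, HasCoproduct M → F.essImage (∐ fun i => F.obj (M i))) (M : E) :
    tria (ObjectProperty.ofObj fun k => F.obj (P k)) (F.obj M) := by
  let W := (tria (ObjectProperty.ofObj fun k => F.obj (P k))).inverseImage F
  have hWc : ClosedUnderCoproducts W := fun J =>
    isClosedUnderColimitsOfShape_inverseImage F (hF J) _ fun X hX =>
      (closedUnderCoproducts_tria _).sigma hX
  have := isClosedUnderColimitsOfShape_inverseImage F hFN
    (tria (ObjectProperty.ofObj fun k => F.obj (P k))) fun X hX =>
      (closedUnderCoproducts_tria _).sigma_nat hX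
  have hWs : nonnegShifts (ObjectProperty.ofObj P) ≤ W := by
    rintro X ⟨n, _, ⟨k⟩, ⟨e⟩⟩
    exact W.prop_of_iso e.symm (W.le_shift (n : ℤ) _ (le_tria _ _ ⟨k⟩))
  obtain ⟨i, G, c, hc, f, g, h, hG, hT⟩ := hP.exists_triangle M
  have hcW : W c.pt := W.prop_of_isColimit hc fun j => finiteExtensions_le (fun X ⟨J, hX⟩ =>
    (hWc J).colimitsOfShape_le _ (ObjectProperty.colimitsOfShape_monotone _ hWs _ hX)) _ (hG j.as)
  have : W (M⟦i⟧) := W.ext_of_isTriangulatedClosed₃ _ hT hcW hcW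
  exact W.prop_of_iso ((shiftEquiv E i).unitIso.app M).symm (W.le_shift (-i) _ this)

end BoundedCoproducts

end TTFRestriction

namespace TTFRestriction

section EssImage

variable {C : Type u} [Category.{v} C] {S : ObjectProperty C} [S.IsClosedUnderIsomorphisms]

lemma essImage_ι_iff (X : C) : S.ι.essImage X ↔ S X :=
  ⟨fun ⟨Y, ⟨e⟩⟩ => S.prop_of_iso e Y.property, fun h => ⟨⟨X, h⟩, ⟨Iso.refl _⟩⟩⟩

lemma essImage_ι_comp_ι_iff {U : ObjectProperty S.FullSubcategory} [U.IsClosedUnderIsomorphisms]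
    (X : C) : (U.ι ⋙ S.ι).essImage X ↔ ofFullSubcategory S U X :=
  ⟨fun ⟨Y, ⟨e⟩⟩ => (ofFullSubcategory S U).prop_of_iso e ⟨Y.obj.property, Y.property⟩,
    fun ⟨h, h'⟩ => ⟨⟨⟨X, h⟩, h'⟩, ⟨Iso.refl _⟩⟩⟩

end EssImage

/-! ### Assembly of the theorem. -/

section Restriction

variable {C : Type u} [Category.{v} C] [HasZeroObject C] [HasShift C ℤ] [Preadditive C]
  [∀ n : ℤ, (shiftFunctor C n).Additive] [Pretriangulated C]

instance (U : ObjectProperty C) : (unionOfShifts U).IsClosedUnderIsomorphisms where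
  of_iso := fun e ⟨n, Y, hY, ⟨e'⟩⟩ => ⟨n, Y, hY, ⟨e.symm ≪≫ e'⟩⟩

variable {S : ObjectProperty C} [S.IsTriangulated] [S.IsClosedUnderIsomorphisms]

/-- The statement for the objects bounded above with respect to a t-structure whose right part is
closed under coproducts. -/
theorem restriction_of_tStructure [HasCoproducts.{v} C] [HasCoproductsOfShape ℕ C]
    {t : TStructure C} (hS : S = t.minus) (hge : ClosedUnderCoproducts (t.ge 1))
    {I : Type v} {Q : I → C} (hQ : ∀ i, PerfectFor ⊤ ℕ (Q i))
    (hQgen : Generates (ObjectProperty.ofObj Q)) (hQt : ∀ i, t.minus (Q i))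
    (T : TTFTriple S.FullSubcategory) {J : Type v} (P : J → T.X.FullSubcategory)
    (hPexh : ExhaustivelyGeneratedToTheLeft (ObjectProperty.ofObj P))
    (hPsup : ∀ j, IsSuperperfect (P j)) :
    (∀ j, IsSuperperfect (P j).obj) ∧
    ∃ S' : TTFTriple C, S'.X = tria (ObjectProperty.ofObj fun j => (P j).obj.obj) ∧
      S'.Y = (tria (ObjectProperty.ofObj fun j => (P j).obj.obj)).rightOrthogonal ∧
      S'.Z = (tria
        (ObjectProperty.ofObj fun j => (P j).obj.obj)).rightOrthogonal.rightOrthogonal ∧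
      S'.RestrictsTo T := by
  have hXs (n : ℤ) (A : S.FullSubcategory) : T.X A → T.X (A⟦n⟧) := T.X.le_shift n A
  obtain ⟨G₁, hYs⟩ := T.isTStructure_XY.isTorsionPair hXs
  obtain ⟨G₂, hZs⟩ := T.isTStructure_YZ.isTorsionPair hYs
  have := G₁.left_iso
  have := G₁.right_iso
  have := G₂.right_iso
  have H₁ := G₁.ofFullSubcategory S
  have H₂ := G₂.ofFullSubcategory S
  have hSt : ∀ M, S M ↔ t.minus M := fun M => by rw [hS]
  have cast {U V : ObjectProperty C} (h : IsTorsionPair S U V) : IsTorsionPair t.minus U V := hS ▸ h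
  replace H₁ := cast H₁
  replace H₂ := cast H₂
  have hX := fun (n : ℤ) (A : C) => ofFullSubcategory_shift S n (hXs n) (X := A)
  have hY := fun (n : ℤ) (A : C) => ofFullSubcategory_shift S n (hYs n) (X := A)
  have hZ := fun (n : ℤ) (A : C) => ofFullSubcategory_shift S n (hZs n) (X := A)
  have hPX : ∀ j, ofFullSubcategory S T.X (P j).obj.obj := fun j => ⟨(P j).obj.2, (P j).2⟩
  -- Read from the inside out: from bounded families in the first term, to all bounded families, to
  -- all families in the ambient category.
  have hPtop : ∀ j (ι : Type v), PerfectFor ⊤ ι (P j).obj.obj := fun j ι => by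
    obtain ⟨m, hm⟩ := (hSt _).1 (P j).obj.2
    refine PerfectFor.top_of_isLE t hge hm
      (PerfectFor.of_isTorsionPair H₁ H₂ hX hY (hPX j) (fun n => ?_) m)
    refine PerfectFor.map (T.X.ι ⋙ S.ι) (p := P j)
      (fun M N f _ _ _ _ h => hPsup j ι M N f h) (fun M hM => ?_) (fun M hM => ?_)
    · exact (essImage_ι_comp_ι_iff M).2 hM.1
    · exact (essImage_ι_comp_ι_iff _).2
        (H₁.left_sigma hX (fun i => (hM i).1) (fun i => ⟨(hM i).2⟩))
  have hF : ∀ (ι : Type v) (M : ι → T.X.FullSubcategory), HasCoproduct M →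
      (T.X.ι ⋙ S.ι).essImage (∐ fun i => (T.X.ι ⋙ S.ι).obj (M i)) := fun ι M _ => by
    obtain ⟨m, hm⟩ := (hSt _).1 (∐ M).obj.2
    exact (essImage_ι_comp_ι_iff _).2 (H₁.left_sigma hX (fun i => ⟨(M i).obj.2, (M i).2⟩)
      (isLE_of_hasCoproduct (T.X.ι ⋙ S.ι) M hm))
  have hFN : ∀ (M : ℕ → T.X.FullSubcategory), HasCoproduct M →
      (T.X.ι ⋙ S.ι).essImage (∐ fun i => (T.X.ι ⋙ S.ι).obj (M i)) := fun M _ => by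
    obtain ⟨m, hm⟩ := (hSt _).1 (∐ M).obj.2
    exact (essImage_ι_comp_ι_iff _).2 (H₁.left_sigma hX (fun i => ⟨(M i).obj.2, (M i).2⟩)
      (isLE_of_hasCoproduct (T.X.ι ⋙ S.ι) M hm))
  refine ⟨fun j ι M N f _ _ h => ?_, ?_⟩
  · refine PerfectFor.of_map S.ι (p := (P j).obj) (hPtop j ι) (fun M _ => ?_) M N f
      (fun _ => trivial) (fun _ => trivial) h
    obtain ⟨m, hm⟩ := (hSt _).1 (∐ M).2
    exact (essImage_ι_iff _).2 ((hSt _).2 ⟨m, isLE_sigma t (isLE_of_hasCoproduct S.ι M hm)⟩)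
  · obtain ⟨S', h₁, h₂, h₃, h⟩ := exists_extension hQ hQgen hQt H₁ H₂ hX hY hZ hPtop hPX
      (fun M ⟨hM, hM'⟩ => hPexh.map_tria (T.X.ι ⋙ S.ι) hF hFN ⟨⟨M, hM⟩, hM'⟩)
    refine ⟨S', h₁, h₂, h₃, ?_, ?_, ?_⟩
    all_goals ext M
    · exact (h M.obj ((hSt _).1 M.2)).1.trans (ofFullSubcategory_iff S M)
    · exact (h M.obj ((hSt _).1 M.2)).2.1.trans (ofFullSubcategory_iff S M)
    · exact (h M.obj ((hSt _).1 M.2)).2.2.trans (ofFullSubcategory_iff S M)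

end Restriction

end TTFRestriction

theorem mainTheorem7 {D : Type u} [Category.{v} D] [Preadditive D] [HasZeroObject D] [HasShift D ℤ]
    [∀ n : ℤ, (shiftFunctor D n).Additive] [Pretriangulated D] [IsTriangulated D]
    [HasCoproducts.{v} D]
    {I : Type v} (Q : I → D)
    (hQperf : ∀ i, TTFRestriction.IsPerfect (Q i))
    (hQgen : TTFRestriction.Generates (ObjectProperty.ofObj Q))
    (hQcoprod : TTFRestriction.ClosedUnderCoproducts
      (TTFRestriction.aisle (ObjectProperty.ofObj Q)).rightOrthogonal)
    (T : TTFRestriction.TTFTriple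
      (TTFRestriction.unionOfShifts (TTFRestriction.aisle (ObjectProperty.ofObj Q))).FullSubcategory)
    {J : Type v} (P : J → T.X.FullSubcategory)
    (hPexh : TTFRestriction.ExhaustivelyGeneratedToTheLeft (ObjectProperty.ofObj P))
    (hPsup : ∀ j, TTFRestriction.IsSuperperfect (P j)) :
    (∀ j, TTFRestriction.IsSuperperfect (P j).obj) ∧
    ∃ S : TTFRestriction.TTFTriple D,
      S.X = TTFRestriction.tria (ObjectProperty.ofObj fun j => (P j).obj.obj) ∧
      S.Y = (TTFRestriction.tria (ObjectProperty.ofObj fun j => (P j).obj.obj)).rightOrthogonal ∧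
      S.Z = (TTFRestriction.tria
        (ObjectProperty.ofObj fun j => (P j).obj.obj)).rightOrthogonal.rightOrthogonal ∧
      S.RestrictsTo T := by
  -- Telescopes are indexed by `ℕ`, which lives in universe 0 and not in `Type v`.
  have : HasCoproducts.{0} D := hasCoproducts_shrink.{0, v}
  have hQ (i : I) := (hQperf i).perfectFor ⊤
  obtain ⟨t, ht⟩ := TTFRestriction.exists_tStructure_of_perfect Q hQ
  refine TTFRestriction.restriction_of_tStructure (t := t) ?_ ?_ hQ hQgen (fun i => ?_) T P hPexh
    hPsup
  · rw [← ht, TTFRestriction.unionOfShifts_eq_minus]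
  · rwa [TTFRestriction.ge_one_eq_rightOrthogonal, ht]
  · refine ⟨0, ⟨?_⟩⟩
    rw [ht]
    exact fun U _ hU => hU _ ⟨i⟩
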